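/- Let a finite group $G$ of order $n$ be given to a (uniform-cost, multiplication-free) random access machine by its Cayley table, the elements being numbered in an arbitrary way, and let a subgroup be specified by the list of its elements. (1) There are one program and one polynomial $p$ (both independent of $G$, $n$ and $k$) such that, given the Cayley table of any finite group $G$ of order $n$ and any integer $k \ge 1$, the program halts after at most $p(n^k)$ steps and outputs the list, without repetitions, of exactly those normal subgroups $A$ of $G$ for which $G/A$ has a subnormal series of length $k$ with cyclic or simple factors, that is, a chain of subgroups $1 = N_k \unlhd N_{k-1} \unlhd \dots \unlhd N_0 = G/A$ such that $N_i/N_{i+1}$ is cyclic (possibly trivial) or simple for every $i = 0, \dots, k-1$. (2) There are a program and a polynomial $q$ such that, given the Cayley table of any finite group $G$ of order $n$, the program halts after at most $q(n)$ steps and outputs the list, without repetitions, of exactly those normal subgroups $A$ of $G$ for which $G/A$ is cyclic or simple. -/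

import Mathlib

/-! ## Random access machine with uniform cost

Programs act on finitely many integer variables and finitely many unbounded one-dimensional
integer arrays (the indexed memory), and write to an append-only output list.  The arithmetic is
addition and truncated subtraction; there is no multiplication, so that unit cost is
polynomially equivalent to time on a Turing machine. -/

namespace RAM

/-- Memory contents: `var x` is the value of the variable number `x`, `arr a i` is the cell number
`i` of the array number `a`, and `out` is what has been written to the output so far. -/
@[ext] structure State where
  var : ℕ → ℕ
  arr : ℕ → ℕ → ℕ
  out : List ℕ

/-- Arithmetic expressions; `get a i` reads the array `a` at the (computed) position `i`. -/
inductive Expr where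
  | const (c : ℕ)
  | var (x : ℕ)
  | get (a : ℕ) (i : Expr)
  | add (e f : Expr)
  | sub (e f : Expr)

/-- The value of an expression (`sub` is truncated subtraction). -/
def Expr.eval (s : State) : Expr → ℕ
  | .const c => c
  | .var x => s.var x
  | .get a i => s.arr a (i.eval s)
  | .add e f => e.eval s + f.eval s
  | .sub e f => e.eval s - f.eval s

/-- The number of elementary operations needed to evaluate an expression. -/
def Expr.cost : Expr → ℕ
  | .const _ => 1
  | .var _ => 1
  | .get _ i => i.cost + 1
  | .add e f => e.cost + f.cost + 1
  | .sub e f => e.cost + f.cost + 1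

/-- Programs. The tests of `cond` and `loop` succeed when the value of the expression is not `0`. -/
inductive Prog where
  | skip
  | assign (x : ℕ) (e : Expr)
  | store (a : ℕ) (i e : Expr)
  | emit (e : Expr)
  | seq (P Q : Prog)
  | cond (e : Expr) (P Q : Prog)
  | loop (e : Expr) (P : Prog)

/-- `Exec P s t s'`: started in the state `s`, the program `P` halts in the state `s'` after
exactly `t` elementary steps. -/
inductive Exec : Prog → State → ℕ → State → Prop where
  | skip (s : State) : Exec .skip s 1 s
  | assign (s : State) (x : ℕ) (e : Expr) :
      Exec (.assign x e) s (e.cost + 1) { s with var := Function.update s.var x (e.eval s) }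
  | store (s : State) (a : ℕ) (i e : Expr) :
      Exec (.store a i e) s (i.cost + e.cost + 1)
        { s with arr := Function.update s.arr a
                          (Function.update (s.arr a) (i.eval s) (e.eval s)) }
  | emit (s : State) (e : Expr) :
      Exec (.emit e) s (e.cost + 1) { s with out := s.out ++ [e.eval s] }
  | seq {P Q : Prog} {s s' s'' : State} {t t' : ℕ} :
      Exec P s t s' → Exec Q s' t' s'' → Exec (.seq P Q) s (t + t') s''
  | cond_true {e : Expr} {P Q : Prog} {s s' : State} {t : ℕ} :
      e.eval s ≠ 0 → Exec P s t s' → Exec (.cond e P Q) s (e.cost + 1 + t) s'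
  | cond_false {e : Expr} {P Q : Prog} {s s' : State} {t : ℕ} :
      e.eval s = 0 → Exec Q s t s' → Exec (.cond e P Q) s (e.cost + 1 + t) s'
  | loop_done {e : Expr} {P : Prog} {s : State} :
      e.eval s = 0 → Exec (.loop e P) s (e.cost + 1) s
  | loop_step {e : Expr} {P : Prog} {s s' s'' : State} {t t' : ℕ} :
      e.eval s ≠ 0 → Exec P s t s' → Exec (.loop e P) s' t' s'' →
      Exec (.loop e P) s (e.cost + 1 + t + t') s''

end RAM

/-! ## Groups given by Cayley tables -/

/-- The initial state for a group `G` of order `n` given by its Cayley table, the elements being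
numbered from `0` to `n - 1` by `e`: variable `0` holds `n`, and the array `0` holds the `n × n`
multiplication table, row by row. Everything else is `0`, and the output is empty. -/
def cayleyInput {G : Type*} [Group G] {n : ℕ} (e : G ≃ Fin n) : RAM.State where
  var x := if x = 0 then n else 0
  arr a i :=
    if h : a = 0 ∧ i < n * n then
      (e (e.symm (Fin.divNat ⟨i, h.2⟩) * e.symm (Fin.modNat ⟨i, h.2⟩)) : ℕ)
    else 0
  out := []

/-- The initial state for a group given by its Cayley table together with a number `k`, which is
held by variable `1`. -/
def cayleyInputWith {G : Type*} [Group G] {n : ℕ} (e : G ≃ Fin n) (k : ℕ) : RAM.State :=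
  { cayleyInput e with var := Function.update (cayleyInput e).var 1 k }

/-- The list `l` consists of the numbers of the elements of `A`, each occurring once. -/
def ListsElements {G : Type*} [Group G] {n : ℕ} (e : G ≃ Fin n) (A : Subgroup G)
    (l : List ℕ) : Prop :=
  l.Nodup ∧ ∀ x : ℕ, x ∈ l ↔ ∃ g ∈ A, (e g : ℕ) = x

/-- The output `out` lists exactly the subgroups with the property `S`, each of them once: every
subgroup is written as its order followed by the list of its elements. -/
def OutputsSubgroups {G : Type*} [Group G] {n : ℕ} (e : G ≃ Fin n) (S : Subgroup G → Prop)
    (out : List ℕ) : Prop :=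
  ∃ (As : List (Subgroup G)) (L : List (List ℕ)),
    As.Nodup ∧ (∀ A, A ∈ As ↔ S A) ∧ List.Forall₂ (ListsElements e) As L ∧
      out = L.flatMap fun l => l.length :: l

/-- Started in the state `s`, the program `P` halts within `T` steps, and its output lists
exactly the subgroups with the property `S`. -/
def FindsSubgroupsInTime {G : Type*} [Group G] {n : ℕ} (e : G ≃ Fin n) (P : RAM.Prog)
    (s : RAM.State) (T : ℕ) (S : Subgroup G → Prop) : Prop :=
  ∃ (t : ℕ) (s' : RAM.State), RAM.Exec P s t s' ∧ t ≤ T ∧ OutputsSubgroups e S s'.out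

/-! ## Subnormal series -/

/-- The group `Q` is cyclic or simple (the trivial group is cyclic). -/
def IsCyclicOrSimple (Q : Type*) [Group Q] : Prop :=
  IsCyclic Q ∨ IsSimpleGroup Q

/-- `H` has a subnormal series `1 = N k ⊴ N (k - 1) ⊴ ⋯ ⊴ N 0 = H` of length `k` in which every
factor is cyclic or simple. -/
def HasCyclicOrSimpleSeries (H : Type*) [Group H] (k : ℕ) : Prop :=
  ∃ N : ℕ → Subgroup H, N 0 = ⊤ ∧ N k = ⊥ ∧ ∀ i < k, N (i + 1) ≤ N i ∧
    ∃ _ : ((N (i + 1)).subgroupOf (N i)).Normal,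
      IsCyclicOrSimple (N i ⧸ (N (i + 1)).subgroupOf (N i))

/-! The search is polynomial because there is little to find. A normal subgroup of H with cyclic
quotient is the kernel of a linear character, and H has |H : [H, H]| of these (`ncard_cyclicIn_le`).
If H/N is non-abelian simple, choose x in H outside N whose normal closure in H is as small as
possible. For y in H outside N, the normal closures of x and y both cover H/N, and H/N is not
abelian, so they share an element z outside N. By minimality z has the same normal closure as x, so
x lies in the normal closure of y. Hence N consists of the elements of H whose normal closure misses
x (`SimpleIn.eq_avoiding`), and x determines N. An abelian simple quotient is cyclic. So H has at
most 2n relevant normal subgroups, and i steps down from G reach at most (2n)^i subgroups, which is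
at most (n^k)^2 if i ≤ k and n ≥ 2. By the correspondence theorem the subgroups A sought are those
reached after k steps that are normal in G (`hasCyclicOrSimpleSeries_quotient_iff`).

The same facts give the algorithm. Non-abelian simple quotients are found by trying every x and
testing the resulting set. For cyclic quotients, Q rises from [H, H] to H by one element at a time,
together with a list of subgroups M ≥ [H, H] with Q/M cyclic that contains N ∩ Q for every N sought.
When Q grows to Q' = Q⟨g⟩, the group (N ∩ Q')/(N ∩ Q) embeds in the cyclic group Q'/Q, so N ∩ Q' =
(N ∩ Q)⟨y⟩ for some y (`exists_inf_sup_eq`). All y are tried, and discarding the candidates with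
non-cyclic quotient keeps each list no longer than n.

The algorithm is written in a small language of formulas, subsets and lists of subsets, reasoned
about by weakest preconditions (`wp`), and compiled to the machine by a translation verified once
(`Cmd.runs`). A program whose loops make at most B passes runs in time bounded by a fixed polynomial
in B (`Prog.time`), and B = (n^k)^2 suffices. The trivial group is exceptional, since n^k = 1 does
not bound k; there k is replaced by 0, which is harmless because all levels coincide. -/

/-! ## Running programs with a polynomial time bound -/

namespace RAM

open Polynomial

/-- A polynomial bound for the running time of a program in terms of a bound for the number of
iterations of each of its loops. -/
noncomputable def Prog.time : Prog → Polynomial ℕ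
  | .skip => 1
  | .assign _ e => C (e.cost + 1)
  | .store _ i e => C (i.cost + e.cost + 1)
  | .emit e => C (e.cost + 1)
  | .seq P Q => P.time + Q.time
  | .cond e P Q => C (e.cost + 1) + P.time + Q.time
  -- The summand 1 pays for the final, failing test.
  | .loop e P => (X + 1) * (C (e.cost + 1) + P.time)

/-- Started in `s`, the program `P` halts in time `P.time.eval B` in a state satisfying `Φ`. -/
def Runs (B : ℕ) (P : Prog) (s : State) (Φ : State → Prop) : Prop :=
  ∃ t s', Exec P s t s' ∧ t ≤ P.time.eval B ∧ Φ s'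

/-- Overwrite a variable. -/
def State.setVar (s : State) (x v : ℕ) : State :=
  { s with var := Function.update s.var x v }

/-- Overwrite an array cell. -/
def State.setArr (s : State) (a i v : ℕ) : State :=
  { s with arr := Function.update s.arr a (Function.update (s.arr a) i v) }

@[simp] theorem State.setVar_var (s : State) (x v y : ℕ) :
    (s.setVar x v).var y = if y = x then v else s.var y := by
  simp [State.setVar, Function.update_apply]

@[simp] theorem State.setVar_arr (s : State) (x v : ℕ) : (s.setVar x v).arr = s.arr := rfl

@[simp] theorem State.setVar_out (s : State) (x v : ℕ) : (s.setVar x v).out = s.out := rfl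

@[simp] theorem State.setArr_var (s : State) (a i v : ℕ) : (s.setArr a i v).var = s.var := rfl

@[simp] theorem State.setArr_out (s : State) (a i v : ℕ) : (s.setArr a i v).out = s.out := rfl

@[simp] theorem State.setArr_arr (s : State) (a i v b j : ℕ) :
    (s.setArr a i v).arr b j = if b = a ∧ j = i then v else s.arr b j := by
  by_cases h : b = a
  · subst h; simp [State.setArr, Function.update_apply]
  · simp [State.setArr, h]

namespace Runs

variable {B : ℕ} {P Q : Prog} {s : State} {Φ Ψ : State → Prop}

theorem mono (h : Runs B P s Φ) (hΦ : ∀ s, Φ s → Ψ s) : Runs B P s Ψ := by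
  obtain ⟨t, s', h1, h2, h3⟩ := h
  exact ⟨t, s', h1, h2, hΦ _ h3⟩

theorem skip (h : Φ s) : Runs B .skip s Φ :=
  ⟨1, s, .skip s, by simp [Prog.time], h⟩

theorem assign {x : ℕ} {e : Expr} (h : Φ (s.setVar x (e.eval s))) : Runs B (.assign x e) s Φ :=
  ⟨_, _, .assign s x e, by simp [Prog.time], h⟩

theorem store {a : ℕ} {i e : Expr} (h : Φ (s.setArr a (i.eval s) (e.eval s))) :
    Runs B (.store a i e) s Φ :=
  ⟨_, _, .store s a i e, by simp [Prog.time], h⟩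

theorem emit {e : Expr} (h : Φ { s with out := s.out ++ [e.eval s] }) :
    Runs B (.emit e) s Φ :=
  ⟨_, _, .emit s e, by simp [Prog.time], h⟩

theorem seq (h : Runs B P s fun s' => Runs B Q s' Φ) : Runs B (.seq P Q) s Φ := by
  obtain ⟨t, s', h1, h2, t', s'', h3, h4, h5⟩ := h
  exact ⟨t + t', s'', .seq h1 h3, by simp only [Prog.time, eval_add]; omega, h5⟩

theorem cond {e : Expr} (h1 : e.eval s ≠ 0 → Runs B P s Φ) (h2 : e.eval s = 0 → Runs B Q s Φ) :
    Runs B (.cond e P Q) s Φ := by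
  by_cases h : e.eval s = 0
  · obtain ⟨t, s', h3, h4, h5⟩ := h2 h
    exact ⟨_, s', .cond_false h h3, by simp only [Prog.time, eval_add, eval_C]; omega, h5⟩
  · obtain ⟨t, s', h3, h4, h5⟩ := h1 h
    exact ⟨_, s', .cond_true h h3, by simp only [Prog.time, eval_add, eval_C]; omega, h5⟩

/-- The invariant is indexed by the passes already made, so the induction is on the number j of
passes still to come. -/
theorem loop {e : Expr} (m : ℕ) (hm : m ≤ B) (I : ℕ → State → Prop) (h0 : I 0 s)
    (hstep : ∀ i < m, ∀ s, I i s → e.eval s ≠ 0 ∧ Runs B P s (I (i + 1)))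
    (hend : ∀ s, I m s → e.eval s = 0 ∧ Φ s) : Runs B (.loop e P) s Φ := by
  have key : ∀ j ≤ m, ∀ s, I (m - j) s → ∃ t s', Exec (.loop e P) s t s' ∧
      t ≤ (j + 1) * (e.cost + 1 + P.time.eval B) ∧ Φ s' := by
    intro j
    induction j with
    | zero =>
      intro _ s hs
      obtain ⟨h1, h2⟩ := hend s hs
      exact ⟨_, s, .loop_done h1, by omega, h2⟩
    | succ j ih =>
      intro hj s hs
      obtain ⟨h1, t, s', h2, h3, h4⟩ := hstep (m - (j + 1)) (by omega) s hs
      rw [show m - (j + 1) + 1 = m - j by omega] at h4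
      obtain ⟨t', s'', h5, h6, h7⟩ := ih (by omega) s' h4
      refine ⟨_, s'', .loop_step h1 h2 h5, ?_, h7⟩
      rw [add_mul (j + 1) 1]
      omega
  obtain ⟨t, s', h1, h2, h3⟩ := key m le_rfl s (by simpa using h0)
  refine ⟨t, s', h1, h2.trans ?_, h3⟩
  simp only [Prog.time, eval_mul, eval_add, eval_X, eval_one, eval_C]
  gcongr

end Runs

/-- `countTo b c P` runs `P` with the variable `c` running from `0` up to the value of the
variable `b` (exclusive). -/
def Prog.countTo (b c : ℕ) (P : Prog) : Prog :=
  .seq (.assign c (.const 0))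
    (.loop (.sub (.var b) (.var c)) (.seq P (.assign c (.add (.var c) (.const 1)))))

theorem Runs.countTo {B : ℕ} {P : Prog} {s : State} {Φ : State → Prop} {b c : ℕ} (m : ℕ)
    (hm : m ≤ B) (hb : s.var b = m) (hbc : b ≠ c) (I : ℕ → State → Prop)
    (h0 : I 0 (s.setVar c 0))
    (hstep : ∀ i < m, ∀ s, s.var c = i → s.var b = m → I i s →
      Runs B P s fun s' => s'.var c = i ∧ s'.var b = m ∧ I (i + 1) (s'.setVar c (i + 1)))
    (hend : ∀ s, I m s → Φ s) : Runs B (.countTo b c P) s Φ := by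
  refine .seq (.assign ?_)
  refine .loop m hm (fun i s => s.var c = i ∧ s.var b = m ∧ I i s)
    ⟨by simp [Expr.eval], by simp [hbc, hb], h0⟩ ?_ ?_
  · rintro i hi s ⟨h1, h2, h3⟩
    refine ⟨by simp [Expr.eval, h1, h2]; omega, .seq ((hstep i hi s h1 h2 h3).mono ?_)⟩
    rintro s' ⟨h4, h5, h6⟩
    refine .assign ⟨by simp [Expr.eval, h4], by simp [hbc, h5], ?_⟩
    simpa [Expr.eval, h4] using h6
  · rintro s ⟨h1, h2, h3⟩
    exact ⟨by simp [Expr.eval, h1, h2], hend s h3⟩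

end RAM

/-! ## A language for computations with elements, subsets and lists of subsets of a group -/

/-- First-order formulas in the multiplication of the group and finitely many set variables. -/
inductive Fml where
  | mem (x a : ℕ)
  | mul (x y z : ℕ)
  | neg (φ : Fml)
  | and (φ ψ : Fml)
  | ex (x : ℕ) (φ : Fml)

namespace Fml

/-- Disjunction. -/
def or (φ ψ : Fml) : Fml := neg (and (neg φ) (neg ψ))

/-- Implication. -/
def imp (φ ψ : Fml) : Fml := neg (and φ (neg ψ))

/-- Universal quantification. -/
def all (x : ℕ) (φ : Fml) : Fml := neg (ex x (neg φ))

variable {G : Type*} [Group G]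

/-- Truth of a formula under an assignment of elements and sets. -/
def Sat (v : ℕ → G) (A : ℕ → Set G) : Fml → Prop
  | mem x a => v x ∈ A a
  | mul x y z => v x * v y = v z
  | neg φ => ¬ φ.Sat v A
  | and φ ψ => φ.Sat v A ∧ ψ.Sat v A
  | ex x φ => ∃ g, φ.Sat (Function.update v x g) A

variable {v : ℕ → G} {A : ℕ → Set G} {φ ψ : Fml} {x y z a : ℕ}

@[simp] theorem sat_mem : (mem x a).Sat v A ↔ v x ∈ A a := Iff.rfl

@[simp] theorem sat_mul : (mul x y z).Sat v A ↔ v x * v y = v z := Iff.rfl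

@[simp] theorem sat_neg : (neg φ).Sat v A ↔ ¬ φ.Sat v A := Iff.rfl

@[simp] theorem sat_and : (and φ ψ).Sat v A ↔ φ.Sat v A ∧ ψ.Sat v A := Iff.rfl

@[simp] theorem sat_ex : (ex x φ).Sat v A ↔ ∃ g, φ.Sat (Function.update v x g) A := Iff.rfl

@[simp] theorem sat_or : (or φ ψ).Sat v A ↔ φ.Sat v A ∨ ψ.Sat v A := by
  simp only [or, sat_neg, sat_and]; tauto

@[simp] theorem sat_imp : (imp φ ψ).Sat v A ↔ (φ.Sat v A → ψ.Sat v A) := by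
  simp only [imp, sat_neg, sat_and]; tauto

@[simp] theorem sat_all : (all x φ).Sat v A ↔ ∀ g, φ.Sat (Function.update v x g) A := by
  simp [all]

end Fml

/-- The values of the element variables, set variables and list variables, and the output. -/
structure AState (G : Type*) where
  elem : ℕ → G
  set : ℕ → Set G
  list : ℕ → List (Set G)
  out : List ℕ

namespace AState

variable {G : Type*}

/-- Overwrite an element variable. -/
def setElem (a : AState G) (x : ℕ) (g : G) : AState G :=
  { a with elem := Function.update a.elem x g }

/-- Overwrite a set variable. -/
def setSet (a : AState G) (x : ℕ) (S : Set G) : AState G :=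
  { a with set := Function.update a.set x S }

/-- Overwrite a list variable. -/
def setList (a : AState G) (l : ℕ) (L : List (Set G)) : AState G :=
  { a with list := Function.update a.list l L }

/-- Append to the output. -/
def addOut (a : AState G) (o : List ℕ) : AState G :=
  { a with out := a.out ++ o }

variable (a : AState G) (x y : ℕ) (g : G) (S : Set G) (L : List (Set G)) (o : List ℕ)

@[simp] theorem setElem_elem :
    (a.setElem x g).elem = Function.update a.elem x g := rfl
@[simp] theorem setElem_set : (a.setElem x g).set = a.set := rfl
@[simp] theorem setElem_list : (a.setElem x g).list = a.list := rfl
@[simp] theorem setElem_out : (a.setElem x g).out = a.out := rfl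
@[simp] theorem setSet_elem : (a.setSet x S).elem = a.elem := rfl
@[simp] theorem setSet_set :
    (a.setSet x S).set = Function.update a.set x S := rfl
@[simp] theorem setSet_list : (a.setSet x S).list = a.list := rfl
@[simp] theorem setSet_out : (a.setSet x S).out = a.out := rfl
@[simp] theorem setList_elem : (a.setList x L).elem = a.elem := rfl
@[simp] theorem setList_set : (a.setList x L).set = a.set := rfl
@[simp] theorem setList_list :
    (a.setList x L).list = Function.update a.list x L := rfl
@[simp] theorem setList_out : (a.setList x L).out = a.out := rfl
@[simp] theorem addOut_elem : (a.addOut o).elem = a.elem := rfl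
@[simp] theorem addOut_set : (a.addOut o).set = a.set := rfl
@[simp] theorem addOut_list : (a.addOut o).list = a.list := rfl
@[simp] theorem addOut_out : (a.addOut o).out = a.out ++ o := rfl

end AState

/-- Commands. Element variables are bound by `forE` only; `rep` repeats a command a number of
times that is fixed in advance, and `forL l x C` runs `C` for every member of the list `l`, which
is put into the set variable `x`. -/
inductive Cmd where
  | skip
  | seq (C D : Cmd)
  | ite (φ : Fml) (C D : Cmd)
  | add (x a : ℕ)
  | del (x a : ℕ)
  | forE (x : ℕ) (C : Cmd)
  | rep (C : Cmd)
  | forL (l x : ℕ) (C : Cmd)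
  | push (l x : ℕ)
  | nil (l : ℕ)
  | emit (x : ℕ)

section

variable {G : Type*} [Group G] {n : ℕ} (e : G ≃ Fin n) (K B : ℕ)

/-- The elements of the group in the order of their numbers. -/
def elemList : List G := (List.finRange n).map e.symm

open Classical in
/-- The numbers below `i` of the elements of a set in increasing order. -/
noncomputable def numbersBelow (S : Set G) (i : ℕ) : List ℕ :=
  (List.range i).filter fun j => ∃ g ∈ S, (e g : ℕ) = j

/-- The numbers of the elements of a set in increasing order. -/
noncomputable def numbers (S : Set G) : List ℕ := numbersBelow e S n

/-- Weakest preconditions. Loops over a list require that the list has length at most `B` and is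
not changed by the body. -/
noncomputable def wp : Cmd → (AState G → Prop) → AState G → Prop
  | .skip, Φ => Φ
  | .seq C D, Φ => wp C (wp D Φ)
  | .ite φ C D, Φ => fun a =>
      (φ.Sat a.elem a.set → wp C Φ a) ∧ (¬ φ.Sat a.elem a.set → wp D Φ a)
  | .add x y, Φ => fun a => Φ (a.setSet y (insert (a.elem x) (a.set y)))
  | .del x y, Φ => fun a => Φ (a.setSet y (a.set y \ {a.elem x}))
  | .forE x C, Φ => fun a =>
      (elemList e).foldr (fun g Ψ b => wp C Ψ (b.setElem x g))
        (fun b => Φ (b.setElem x (a.elem x))) a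
  | .rep C, Φ => (wp C)^[K] Φ
  | .forL l x C, Φ => fun a => (a.list l).length ≤ B ∧
      (a.list l).foldr (fun S Ψ b => b.list l = a.list l ∧ wp C Ψ (b.setSet x S))
        (fun b => b.list l = a.list l ∧ Φ b) a
  | .push l x, Φ => fun a => Φ (a.setList l (a.list l ++ [a.set x]))
  | .nil l, Φ => fun a => Φ (a.setList l [])
  | .emit x, Φ => fun a => Φ (a.addOut ((numbers e (a.set x)).length :: numbers e (a.set x)))

variable {e K B}

theorem wp_mono {C : Cmd} {Φ Ψ : AState G → Prop} (h : ∀ a, Φ a → Ψ a) (a : AState G)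
    (hC : wp e K B C Φ a) : wp e K B C Ψ a := by
  induction C generalizing Φ Ψ a with
  | skip => exact h a hC
  | seq C D ihC ihD => exact ihC (fun b => ihD h b) a hC
  | ite φ C D ihC ihD => exact ⟨fun hs => ihC h a (hC.1 hs), fun hs => ihD h a (hC.2 hs)⟩
  | add | del | push | nil | emit => exact h _ hC
  | forE x C ih =>
    simp only [wp] at hC ⊢
    generalize a.elem x = g0 at hC ⊢
    revert a
    induction elemList e with
    | nil => exact fun a hC => h _ hC
    | cons g L ihL => exact fun a hC => ih ihL _ hC
  | rep C ih =>
    have aux : ∀ j : ℕ, ∀ a, (wp e K B C)^[j] Φ a → (wp e K B C)^[j] Ψ a := by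
      intro j
      induction j with
      | zero => exact h
      | succ j ihj =>
        intro a hC
        rw [Function.iterate_succ_apply'] at hC ⊢
        exact ih ihj a hC
    exact aux K a hC
  | forL l x C ih =>
    have aux : ∀ L0 L : List (Set G), ∀ a : AState G,
        L.foldr (fun S Ψ b => b.list l = L0 ∧ wp e K B C Ψ (b.setSet x S))
          (fun b => b.list l = L0 ∧ Φ b) a →
        L.foldr (fun S Ψ b => b.list l = L0 ∧ wp e K B C Ψ (b.setSet x S))
          (fun b => b.list l = L0 ∧ Ψ b) a := by
      intro L0 L
      induction L with
      | nil => exact fun a hC => ⟨hC.1, h _ hC.2⟩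
      | cons S L ihL => exact fun a hC => ⟨hC.1, ih ihL _ hC.2⟩
    exact ⟨hC.1, aux _ _ a hC.2⟩

end

/-! ## Compilation to the random access machine -/

open RAM

/-- A program that decides a formula; the result is left in the scratch variable number `d`, and
only scratch variables from number `d` on are modified. -/
def Fml.prog : Fml → ℕ → Prog
  | mem x a, d => .assign (3 * d + 4) (.get (2 * a + 2) (.var (3 * x + 2)))
  | mul x y z, d =>
      -- Of the two truncated differences at most one is nonzero; their sum vanishes exactly when
      -- the product equals `z`.
      .assign (3 * d + 4) (.sub (.const 1)
        (.add
          (.sub (.get 0 (.add (.get 1 (.var (3 * x + 2))) (.var (3 * y + 2))))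
            (.var (3 * z + 2)))
          (.sub (.var (3 * z + 2))
            (.get 0 (.add (.get 1 (.var (3 * x + 2))) (.var (3 * y + 2)))))))
  | neg φ, d => .seq (φ.prog d) (.assign (3 * d + 4) (.sub (.const 1) (.var (3 * d + 4))))
  | and φ ψ, d => .seq (φ.prog d) (.cond (.var (3 * d + 4)) (ψ.prog d) .skip)
  | ex x φ, d =>
      .seq (.assign (3 * d + 4) (.const 0)) <|
      .seq (.assign (3 * (d + 1) + 4) (.var (3 * x + 2))) <|
      .seq (.countTo 0 (3 * (d + 2) + 4) <|
        .seq (.assign (3 * x + 2) (.var (3 * (d + 2) + 4))) <|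
        .seq (φ.prog (d + 3)) <|
        .cond (.var (3 * (d + 3) + 4)) (.assign (3 * d + 4) (.const 1)) .skip) <|
      .assign (3 * x + 2) (.var (3 * (d + 1) + 4))

/-- The program of a command, with scratch variables from number `d` on. -/
def Cmd.prog : Cmd → ℕ → Prog
  | skip, _ => .skip
  | seq C D, d => .seq (C.prog d) (D.prog d)
  | ite φ C D, d => .seq (φ.prog d) (.cond (.var (3 * d + 4)) (C.prog d) (D.prog d))
  | add x y, _ => .store (2 * y + 2) (.var (3 * x + 2)) (.const 1)
  | del x y, _ => .store (2 * y + 2) (.var (3 * x + 2)) (.const 0)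
  | forE x C, d =>
      .seq (.assign (3 * d + 4) (.var (3 * x + 2))) <|
      .seq (.countTo 0 (3 * (d + 1) + 4) <|
        .seq (.assign (3 * x + 2) (.var (3 * (d + 1) + 4))) (C.prog (d + 2))) <|
      .assign (3 * x + 2) (.var (3 * d + 4))
  | rep C, d => .countTo 1 (3 * d + 4) (C.prog (d + 1))
  | forL l x C, d =>
      .seq (.assign (3 * d + 4) (.const 0)) <|
      .loop (.sub (.var (3 * l + 3)) (.var (3 * d + 4))) <|
      -- The loop position runs through multiples of the group order, so that it is at once the
      -- offset of a row and comparable with the stored length.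
      .seq (.countTo 0 (3 * (d + 1) + 4) <|
        .store (2 * x + 2) (.var (3 * (d + 1) + 4))
          (.get (2 * l + 3) (.add (.var (3 * d + 4)) (.var (3 * (d + 1) + 4))))) <|
      .seq (C.prog (d + 1)) (.assign (3 * d + 4) (.add (.var (3 * d + 4)) (.var 0)))
  | push l x, d =>
      .seq (.countTo 0 (3 * d + 4) <|
        .store (2 * l + 3) (.add (.var (3 * l + 3)) (.var (3 * d + 4)))
          (.get (2 * x + 2) (.var (3 * d + 4)))) <|
      .assign (3 * l + 3) (.add (.var (3 * l + 3)) (.var 0))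
  | nil l, _ => .assign (3 * l + 3) (.const 0)
  | emit x, d =>
      .seq (.assign (3 * d + 4) (.const 0)) <|
      .seq (.countTo 0 (3 * (d + 1) + 4) <|
        .cond (.get (2 * x + 2) (.var (3 * (d + 1) + 4)))
          (.assign (3 * d + 4) (.add (.var (3 * d + 4)) (.const 1))) .skip) <|
      .seq (.emit (.var (3 * d + 4))) <|
      .countTo 0 (3 * (d + 1) + 4) <|
        .cond (.get (2 * x + 2) (.var (3 * (d + 1) + 4)))
          (.emit (.var (3 * (d + 1) + 4))) .skip

namespace AState

variable {G : Type*} (a : AState G)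

@[simp] theorem setElem_setElem (x : ℕ) (g h : G) :
    (a.setElem x g).setElem x h = a.setElem x h := by
  simp [setElem]

@[simp] theorem setElem_elem_self (x : ℕ) : a.setElem x (a.elem x) = a := by
  simp [setElem]

@[simp] theorem setSet_set_self (x : ℕ) : a.setSet x (a.set x) = a := by
  simp [setSet]

@[simp] theorem setSet_setSet (x : ℕ) (S T : Set G) :
    (a.setSet x S).setSet x T = a.setSet x T := by
  simp [setSet]

end AState

/-! ### Correctness of compiled formulas -/

section

variable {G : Type*} [Group G] {n : ℕ} {e : G ≃ Fin n} {K B : ℕ}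

/-- The memory `s` represents the abstract state `a`. -/
structure Represents (e : G ≃ Fin n) (K : ℕ) (s : State) (a : AState G) : Prop where
  -- Residues modulo 3 separate element variables, list lengths and scratch variables; parity
  -- separates the arrays of sets and of lists. The numbers 0 and 1 are reserved.
  size : s.var 0 = n
  iter : s.var 1 = K
  table : ∀ g h : G, s.arr 0 ((e g : ℕ) * n + e h) = e (g * h)
  -- There is no multiplication, so row offsets are tabulated here; for the same reason the length
  -- of a list is stored multiplied by `n`.
  offset : ∀ g : G, s.arr 1 (e g) = e g * n
  elem : ∀ x, s.var (3 * x + 2) = e (a.elem x)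
  set : ∀ x g, s.arr (2 * x + 2) (e g) ≠ 0 ↔ g ∈ a.set x
  len : ∀ l, s.var (3 * l + 3) = (a.list l).length * n
  row : ∀ l i (hi : i < (a.list l).length) g,
    s.arr (2 * l + 3) (i * n + e g) ≠ 0 ↔ g ∈ (a.list l)[i]
  out : s.out = a.out

/-- The scratch variables below number `d` have the same values in both states. -/
def SameBelow (d : ℕ) (s s' : State) : Prop := ∀ j < d, s'.var (3 * j + 4) = s.var (3 * j + 4)

theorem SameBelow.refl (d : ℕ) (s : State) : SameBelow d s s := fun _ _ => rfl

theorem SameBelow.trans {d : ℕ} {s s' s'' : State} (h : SameBelow d s s')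
    (h' : SameBelow d s' s'') : SameBelow d s s'' :=
  fun j hj => (h' j hj).trans (h j hj)

theorem SameBelow.mono {d d' : ℕ} {s s' : State} (h : SameBelow d s s') (hd : d' ≤ d) :
    SameBelow d' s s' :=
  fun j hj => h j (hj.trans_le hd)

theorem SameBelow.setScratch {d j v : ℕ} {s s' : State} (h : SameBelow d s s') (hd : d ≤ j) :
    SameBelow d s (s'.setVar (3 * j + 4) v) := by
  intro i hi
  rw [State.setVar_var, if_neg (by omega), h i hi]

theorem SameBelow.setElem {d x v : ℕ} {s s' : State} (h : SameBelow d s s') :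
    SameBelow d s (s'.setVar (3 * x + 2) v) := by
  intro i hi
  rw [State.setVar_var, if_neg (by omega), h i hi]

theorem SameBelow.setLen {d x v : ℕ} {s s' : State} (h : SameBelow d s s') :
    SameBelow d s (s'.setVar (3 * x + 3) v) := by
  intro i hi
  rw [State.setVar_var, if_neg (by omega), h i hi]

namespace Represents

variable {s : State} {a : AState G}

theorem setScratch (h : Represents e K s a) (d v : ℕ) :
    Represents e K (s.setVar (3 * d + 4) v) a where
  size := by rw [State.setVar_var, if_neg (by omega), h.size]
  iter := by rw [State.setVar_var, if_neg (by omega), h.iter]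
  table := h.table
  offset := h.offset
  elem x := by rw [State.setVar_var, if_neg (by omega), h.elem]
  set := h.set
  len x := by rw [State.setVar_var, if_neg (by omega), h.len]
  row := h.row
  out := h.out

theorem setElem (h : Represents e K s a) (x : ℕ) (g : G) :
    Represents e K (s.setVar (3 * x + 2) (e g)) (a.setElem x g) where
  size := by rw [State.setVar_var, if_neg (by omega), h.size]
  iter := by rw [State.setVar_var, if_neg (by omega), h.iter]
  table := h.table
  offset := h.offset
  elem y := by
    by_cases hy : y = x
    · subst hy; simp
    · rw [State.setVar_var, if_neg (by omega), h.elem]; simp [hy]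
  set := h.set
  len x := by rw [State.setVar_var, if_neg (by omega), h.len]; rfl
  row := h.row
  out := h.out

theorem setSet (h : Represents e K s a) (x v : ℕ) (g : G) (S : Set G)
    (hg : v ≠ 0 ↔ g ∈ S) (hS : ∀ k, k ≠ g → (k ∈ a.set x ↔ k ∈ S)) :
    Represents e K (s.setArr (2 * x + 2) (e g) v) (a.setSet x S) where
  size := h.size
  iter := h.iter
  table g h' := by rw [State.setArr_arr, if_neg (by omega), h.table]
  offset g := by rw [State.setArr_arr, if_neg (by omega), h.offset]
  elem := h.elem
  set y k := by
    rw [State.setArr_arr]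
    by_cases hy : y = x
    · subst hy
      by_cases hk : k = g
      · subst hk; simpa using hg
      · have : (e k : ℕ) ≠ e g := fun h' => hk (e.injective (Fin.ext h'))
        rw [if_neg (by tauto), h.set, hS k hk]; simp
    · rw [if_neg (by omega), h.set]; simp [hy]
  len := h.len
  row l i hi g := by rw [State.setArr_arr, if_neg (by omega)]; exact h.row l i hi g
  out := h.out

end Represents

theorem Fml.runs (hB : n ≤ B) (φ : Fml) (d : ℕ) {s : State} {a : AState G}
    (h : Represents e K s a) :
    Runs B (φ.prog d) s fun s' => Represents e K s' a ∧ SameBelow d s s' ∧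
      (s'.var (3 * d + 4) ≠ 0 ↔ φ.Sat a.elem a.set) := by
  induction φ generalizing d s a with
  | mem x y =>
    refine .assign ⟨h.setScratch _ _, (SameBelow.refl d s).setScratch le_rfl, ?_⟩
    simp only [Expr.eval, State.setVar_var, if_true, sat_mem, h.elem, h.set]
  | mul x y z =>
    refine .assign ⟨h.setScratch _ _, (SameBelow.refl d s).setScratch le_rfl, ?_⟩
    simp only [Expr.eval, State.setVar_var, if_true, sat_mul, h.elem, h.offset, h.table]
    rw [← e.injective.eq_iff, Fin.ext_iff]
    omega
  | neg φ ih =>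
    refine .seq ((ih d h).mono ?_)
    rintro s1 ⟨h1, h2, h3⟩
    refine .assign ⟨h1.setScratch _ _, h2.setScratch le_rfl, ?_⟩
    simp only [Expr.eval, State.setVar_var, if_true, sat_neg, ← h3]
    omega
  | and φ ψ ihφ ihψ =>
    refine .seq ((ihφ d h).mono ?_)
    rintro s1 ⟨h1, h2, h3⟩
    refine .cond (fun hc => (ihψ d h1).mono ?_) (fun hc => .skip ⟨h1, h2, ?_⟩)
    · rintro s2 ⟨h4, h5, h6⟩
      exact ⟨h4, h2.trans h5, by simp only [Expr.eval] at hc; simp [h6, h3.1 hc]⟩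
    · simp only [Expr.eval] at hc
      simp only [hc, sat_and]
      tauto
  | ex x φ ih =>
    refine .seq (.assign (.seq (.assign ?_)))
    set s0 := (s.setVar (3 * d + 4) ((Expr.const 0).eval s)) with hs0
    have hs0' : Represents e K s0 a := h.setScratch _ _
    have hv0 : s0.var (3 * d + 4) = 0 := by simp [hs0, Expr.eval]
    have hb0 : SameBelow d s s0 := (SameBelow.refl d s).setScratch le_rfl
    clear_value s0
    refine .seq (.countTo n hB ((hs0'.setScratch _ _).size) (by omega)
      -- During the search the variable `x` holds some arbitrary element; its old value waits in a
      -- scratch variable and is restored at the end.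
      (fun i s1 => (∃ g, Represents e K s1 (a.setElem x g)) ∧ SameBelow d s s1 ∧
        s1.var (3 * (d + 1) + 4) = e (a.elem x) ∧
        (s1.var (3 * d + 4) ≠ 0 ↔
          ∃ g, (e g : ℕ) < i ∧ φ.Sat (Function.update a.elem x g) a.set)) ?_ ?_ ?_)
    · refine ⟨⟨a.elem x, by simpa using (hs0'.setScratch _ _).setScratch _ _⟩,
        (hb0.setScratch (by omega)).setScratch (by omega), ?_, ?_⟩
      · simp [Expr.eval, hs0'.elem]
      · simp [hv0]
    · rintro i hi s1 h1 - ⟨⟨g', h2⟩, h3, h4, h5⟩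
      refine .seq (.assign ?_)
      simp only [Expr.eval, h1]
      set g := e.symm ⟨i, hi⟩ with hg
      have heg : (e g : ℕ) = i := by simp [hg]
      have h6 := h2.setElem x g
      rw [heg] at h6
      have h7 : SameBelow (d + 3) s1 (s1.setVar (3 * x + 2) i) := (SameBelow.refl _ _).setElem
      refine .seq ((ih (d + 3) h6).mono ?_)
      rintro s2 ⟨h8, h9, h10⟩
      have h11 := h7.trans h9
      simp only [AState.setElem_setElem, AState.setElem_elem, AState.setElem_set] at h8 h10
      have hd : s2.var (3 * d + 4) = s1.var (3 * d + 4) := h11 d (by omega)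
      have hd1 : s2.var (3 * (d + 1) + 4) = e (a.elem x) := by rw [h11 (d + 1) (by omega), h4]
      have hd2 : s2.var (3 * (d + 2) + 4) = i := by rw [h11 (d + 2) (by omega), h1]
      have hsplit : (∃ g, (e g : ℕ) < i + 1 ∧ φ.Sat (Function.update a.elem x g) a.set) ↔
          (∃ g, (e g : ℕ) < i ∧ φ.Sat (Function.update a.elem x g) a.set) ∨
            φ.Sat (Function.update a.elem x g) a.set := by
        constructor
        · rintro ⟨k, hk, hk'⟩
          rcases Nat.lt_succ_iff_lt_or_eq.1 hk with hk | hk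
          · exact .inl ⟨k, hk, hk'⟩
          · have : k = g := e.injective (Fin.ext (hk.trans heg.symm))
            exact .inr (this ▸ hk')
        · rintro (⟨k, hk, hk'⟩ | hk)
          · exact ⟨k, by omega, hk'⟩
          · exact ⟨g, by omega, hk⟩
      refine .cond (fun hc => .assign ⟨?_, ?_, ⟨g, ?_⟩, ?_, ?_, ?_⟩)
        (fun hc => .skip ⟨hd2, h8.size, ⟨g, h8.setScratch _ _⟩,
          (h3.trans (h11.mono (by omega))).setScratch (by omega), ?_, ?_⟩)
      · simpa using hd2
      · exact (h8.setScratch _ _).size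
      · exact (h8.setScratch _ _).setScratch _ _
      · exact ((h3.trans (h11.mono (by omega))).setScratch le_rfl).setScratch (by omega)
      · simpa using hd1
      · simp only [Expr.eval] at hc
        rw [hsplit]
        simp [Expr.eval, h10.1 hc]
      · simpa using hd1
      · simp only [Expr.eval] at hc
        rw [hsplit, State.setVar_var, if_neg (by omega), hd, h5]
        have : ¬ φ.Sat (Function.update a.elem x g) a.set := fun h' => h10.2 h' hc
        exact (or_iff_left this).symm
    · rintro s1 ⟨⟨g, h2⟩, h3, h4, h5⟩
      refine .assign ⟨?_, h3.setElem, ?_⟩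
      · simpa [Expr.eval, h4] using h2.setElem x (a.elem x)
      · rw [State.setVar_var, if_neg (by omega), h5]
        simp

end

/-! ### Correctness of compiled commands -/

section

variable {G : Type*} {n : ℕ} {e : G ≃ Fin n} {K B : ℕ}

theorem mem_elemList (g : G) : g ∈ elemList e :=
  List.mem_map.2 ⟨e g, List.mem_finRange _, by simp⟩

theorem elemList_drop {i : ℕ} (hi : i < n) :
    (elemList e).drop i = e.symm ⟨i, hi⟩ :: (elemList e).drop (i + 1) := by
  rw [List.drop_eq_getElem_cons (by simpa [elemList] using hi)]
  simp [elemList]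

theorem elemList_drop_length : (elemList e).drop n = [] := by
  simp [elemList]

theorem numbersBelow_succ (S : Set G) {i : ℕ} {g : G} (hg : (e g : ℕ) = i) (h : g ∈ S) :
    numbersBelow e S (i + 1) = numbersBelow e S i ++ [i] := by
  rw [numbersBelow, List.range_succ, List.filter_append]
  simp only [numbersBelow, List.append_cancel_left_eq]
  simpa using ⟨g, h, hg⟩

theorem numbersBelow_succ_of_notMem (S : Set G) {i : ℕ} {g : G} (hg : (e g : ℕ) = i)
    (h : g ∉ S) : numbersBelow e S (i + 1) = numbersBelow e S i := by
  rw [numbersBelow, List.range_succ, List.filter_append]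
  simp only [numbersBelow, List.append_right_eq_self]
  suffices ¬ ∃ g ∈ S, (e g : ℕ) = i by simpa using this
  rintro ⟨k, hk, hk'⟩
  exact h (e.injective (Fin.ext (hg.trans hk'.symm)) ▸ hk)

variable [Group G]

namespace Represents

variable {s : State} {a : AState G}

theorem runs_load (hB : n ≤ B) (h : Represents e K s a) {l i d : ℕ} (x : ℕ)
    (hi : i < (a.list l).length) (hd : s.var (3 * d + 4) = i * n) :
    Runs B (.countTo 0 (3 * (d + 1) + 4) <|
        .store (2 * x + 2) (.var (3 * (d + 1) + 4))
          (.get (2 * l + 3) (.add (.var (3 * d + 4)) (.var (3 * (d + 1) + 4))))) s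
      fun s' => Represents e K s' (a.setSet x (a.list l)[i]) ∧ SameBelow (d + 1) s s' := by
  refine .countTo n hB h.size (by omega)
    -- Halfway through the copying, elements numbered below `j` follow the row and the others still
    -- follow the old set.
    (fun j s1 => Represents e K s1
      (a.setSet x {g | ((e g : ℕ) < j ∧ g ∈ (a.list l)[i]) ∨ (j ≤ e g ∧ g ∈ a.set x)}) ∧
        SameBelow (d + 1) s s1) ?_ ?_ ?_
  · exact ⟨by simpa using h.setScratch (d + 1) 0, (SameBelow.refl _ _).setScratch le_rfl⟩
  · rintro j hj s1 h1 h2 ⟨h3, h4⟩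
    set g := e.symm ⟨j, hj⟩ with hg
    have heg : (e g : ℕ) = j := by simp [hg]
    have h5 : s1.var (3 * d + 4) = i * n := by rw [h4 d (by omega), hd]
    refine .store ⟨h1, h2, ?_, ?_⟩
    · simp only [Expr.eval, h1, h5]
      rw [← heg]
      have h6 := h3.setSet x (s1.arr (2 * l + 3) (i * n + e g)) g
        {g | ((e g : ℕ) < j + 1 ∧ g ∈ (a.list l)[i]) ∨ (j + 1 ≤ e g ∧ g ∈ a.set x)} ?_ ?_
      · rw [heg] at h6 ⊢
        simpa using h6.setScratch (d + 1) (j + 1)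
      · rw [h3.row l i hi g]
        simp [heg]
      · intro k hk
        have : (e k : ℕ) ≠ j := fun h' => hk (e.injective (Fin.ext (h'.trans heg.symm)))
        have h7 : (e k : ℕ) < j + 1 ↔ (e k : ℕ) < j := by omega
        have h8 : j + 1 ≤ (e k : ℕ) ↔ j ≤ (e k : ℕ) := by omega
        simp only [AState.setSet_set, Function.update_self, Set.mem_ofPred_eq, h7, h8]
    · exact SameBelow.setScratch (show SameBelow (d + 1) s (s1.setArr _ _ _) from h4) le_rfl
  · rintro s1 ⟨h1, h2⟩
    refine ⟨?_, h2⟩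
    convert h1 using 2
    ext g
    simp [(e g).2]

theorem runs_push (hB : n ≤ B) (h : Represents e K s a) (l x d : ℕ) :
    Runs B ((Cmd.push l x).prog d) s fun s' => SameBelow d s s' ∧
      Represents e K s' (a.setList l (a.list l ++ [a.set x])) := by
  -- Rows do not overlap: writing the row behind the last one leaves the earlier rows intact.
  have hpos : ∀ (i j k : ℕ), i < j → k < n → i * n + k < j * n := by
    intro i j k hi hk
    calc i * n + k < i * n + n := by omega
      _ = (i + 1) * n := by ring
      _ ≤ j * n := Nat.mul_le_mul_right _ hi
  refine .seq (.countTo n hB h.size (by omega)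
    (fun j s1 => Represents e K s1 a ∧ SameBelow d s s1 ∧ ∀ g, (e g : ℕ) < j →
      (s1.arr (2 * l + 3) ((a.list l).length * n + e g) ≠ 0 ↔ g ∈ a.set x)) ?_ ?_ ?_)
  · exact ⟨h.setScratch _ _, (SameBelow.refl _ _).setScratch le_rfl, by simp⟩
  · rintro j hj s1 h1 h2 ⟨h3, h4, h5⟩
    set g := e.symm ⟨j, hj⟩ with hg
    have heg : (e g : ℕ) = j := by simp [hg]
    refine .store ⟨h1, h2, ?_, ?_, ?_⟩
    · simp only [Expr.eval, h1, h3.len]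
      refine Represents.setScratch ?_ _ _
      exact
        { size := h3.size
          iter := h3.iter
          table := fun g h' => by rw [State.setArr_arr, if_neg (by omega), h3.table]
          offset := fun g => by rw [State.setArr_arr, if_neg (by omega), h3.offset]
          elem := h3.elem
          set := fun y k => by rw [State.setArr_arr, if_neg (by omega), h3.set]
          len := h3.len
          row := fun l' i hi k => by
            rw [State.setArr_arr, if_neg, h3.row]
            rintro ⟨hl, hl'⟩
            obtain rfl : l' = l := by omega
            have := hpos i _ (e k) hi (e k).2
            omega
          out := h3.out }
    · exact SameBelow.setScratch (show SameBelow d s (s1.setArr _ _ _) from h4) le_rfl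
    · intro k hk
      simp only [Expr.eval, h1, h3.len, State.setVar_arr, State.setArr_arr]
      by_cases hkj : (e k : ℕ) = j
      · have : k = g := e.injective (Fin.ext (hkj.trans heg.symm))
        rw [if_pos ⟨trivial, by rw [hkj]⟩, ← hkj, h3.set]
      · rw [if_neg (by omega)]
        exact h5 k (by omega)
  · rintro s1 ⟨h1, h2, h3⟩
    refine .assign ⟨h2.setLen, ?_⟩
    simp only [Expr.eval, h1.len, h1.size]
    exact
      { size := by rw [State.setVar_var, if_neg (by omega), h1.size]
        iter := by rw [State.setVar_var, if_neg (by omega), h1.iter]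
        table := h1.table
        offset := h1.offset
        elem := fun y => by rw [State.setVar_var, if_neg (by omega), h1.elem]; rfl
        set := h1.set
        len := fun l' => by
          by_cases hl : l' = l
          · subst hl; simp; ring
          · rw [State.setVar_var, if_neg (by omega), h1.len]; simp [hl]
        row := fun l' i hi g => by
          by_cases hl : l' = l
          · subst hl
            simp only [AState.setList_list, Function.update_self] at hi ⊢
            rw [List.getElem_append]
            split_ifs with hi'
            · exact h1.row l' i hi' g
            · obtain rfl : i = (a.list l').length := by simp at hi; omega
              simpa using h3 g (e g).2
          · simp only [AState.setList_list, Function.update_of_ne hl] at hi ⊢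
            exact h1.row l' i hi g
        out := h1.out }

theorem runs_emit (hB : n ≤ B) (h : Represents e K s a) (x d : ℕ) :
    Runs B ((Cmd.emit x).prog d) s fun s' => SameBelow d s s' ∧
      Represents e K s'
        (a.addOut ((numbers e (a.set x)).length :: numbers e (a.set x))) := by
  have hfull : numbers e (a.set x) = numbersBelow e (a.set x) n := rfl
  have addOut : ∀ {s a}, Represents e K s a → ∀ o : List ℕ,
      Represents e K { s with out := s.out ++ o } (a.addOut o) := fun {s a} h o =>
    { h with out := by simp [h.out] }
  refine .seq (.assign (.seq (.countTo n hB (h.setScratch _ _).size (by omega)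
    (fun i s1 => Represents e K s1 a ∧ SameBelow d s s1 ∧
      s1.var (3 * d + 4) = (numbersBelow e (a.set x) i).length) ?_ ?_ ?_)))
  · exact ⟨(h.setScratch _ _).setScratch _ _,
      ((SameBelow.refl _ _).setScratch le_rfl).setScratch (by omega), by
        simp [Expr.eval, numbersBelow]⟩
  · rintro i hi s1 h1 h2 ⟨h3, h4, h5⟩
    set g := e.symm ⟨i, hi⟩ with hg
    have heg : (e g : ℕ) = i := by simp [hg]
    have hev : ((Expr.get (2 * x + 2) (.var (3 * (d + 1) + 4))).eval s1 ≠ 0 ↔ g ∈ a.set x) := by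
      simp only [Expr.eval, h1]
      rw [← h3.set, heg]
    refine .cond (fun hc => .assign ⟨?_, ?_, ?_, ?_, ?_⟩) (fun hc => .skip ⟨h1, h2,
      h3.setScratch _ _, h4.setScratch (by omega), ?_⟩)
    · rw [State.setVar_var, if_neg (by omega), h1]
    · rw [State.setVar_var, if_neg (by omega), h2]
    · exact (h3.setScratch _ _).setScratch _ _
    · exact (h4.setScratch le_rfl).setScratch (by omega)
    · rw [numbersBelow_succ _ heg (hev.1 hc)]
      simp [Expr.eval, h5]
    · rw [numbersBelow_succ_of_notMem _ heg (fun h' => hev.2 h' hc),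
        State.setVar_var, if_neg (by omega), h5]
  rintro s1 ⟨h1, h2, h3⟩
  refine .seq (.emit ?_)
  have h4 := addOut h1 [s1.var (3 * d + 4)]
  refine .countTo n hB h4.size (by omega)
    (fun i s1 => Represents e K s1 (a.addOut ((numbers e (a.set x)).length ::
      numbersBelow e (a.set x) i)) ∧ SameBelow d s s1) ?_ ?_ ?_
  · refine ⟨?_, ?_⟩
    · have h5 := h4.setScratch (d + 1) 0
      rw [h3, ← hfull] at h5
      have h6 : numbersBelow e (a.set x) 0 = [] := by simp [numbersBelow]
      simp only [Expr.eval]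
      rwa [h6, h3, ← hfull]
    · exact SameBelow.setScratch (show SameBelow d s { s1 with out := _ } from h2) (by omega)
  · rintro i hi s2 h5 h6 ⟨h7, h8⟩
    set g := e.symm ⟨i, hi⟩ with hg
    have heg : (e g : ℕ) = i := by simp [hg]
    have hev : ((Expr.get (2 * x + 2) (.var (3 * (d + 1) + 4))).eval s2 ≠ 0 ↔ g ∈ a.set x) := by
      simp only [Expr.eval, h5]
      rw [← heg, h7.set]
      rfl
    refine .cond (fun hc => .emit ⟨h5, h6, ?_, ?_⟩) (fun hc => .skip ⟨h5, h6, ?_, ?_⟩)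
    · rw [numbersBelow_succ _ heg (hev.1 hc)]
      have := (addOut h7 [s2.var (3 * (d + 1) + 4)]).setScratch (d + 1) (i + 1)
      rw [h5] at this
      simpa [Expr.eval, h5, AState.addOut] using this
    · exact SameBelow.setScratch (show SameBelow d s { s2 with out := _ } from h8) (by omega)
    · rw [numbersBelow_succ_of_notMem _ heg (fun h' => hev.2 h' hc)]
      exact h7.setScratch _ _
    · exact h8.setScratch (by omega)
  · rintro s2 ⟨h5, h6⟩
    exact ⟨h6, h5⟩

end Represents

/-- This is the only bridge from abstract commands to the machine: loops over elements make `n`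
passes, `rep` makes `K`, and `wp` itself demands that lists have length at most `B`, so `B` bounds
every loop. -/
theorem Cmd.runs (hB : n ≤ B) (hK : K ≤ B) (C : Cmd) (d : ℕ) {s : State} {a : AState G}
    {Φ : AState G → Prop} (h : Represents e K s a) (hC : wp e K B C Φ a) :
    Runs B (C.prog d) s fun s' => SameBelow d s s' ∧ ∃ b, Represents e K s' b ∧ Φ b := by
  induction C generalizing d s a Φ with
  | skip => exact .skip ⟨.refl _ _, a, h, hC⟩
  | seq C D ihC ihD =>
    refine .seq ((ihC d h hC).mono ?_)
    rintro s1 ⟨h1, b, h2, h3⟩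
    refine (ihD d h2 h3).mono ?_
    rintro s2 ⟨h4, b, h5, h6⟩
    exact ⟨h1.trans h4, b, h5, h6⟩
  | ite φ C D ihC ihD =>
    refine .seq ((φ.runs hB d h).mono ?_)
    rintro s1 ⟨h1, h2, h3⟩
    refine .cond (fun hc => (ihC d h1 (hC.1 (h3.1 hc))).mono ?_)
      (fun hc => (ihD d h1 (hC.2 (fun h' => h3.2 h' hc))).mono ?_)
    all_goals
      rintro s2 ⟨h4, b, h5, h6⟩
      exact ⟨h2.trans h4, b, h5, h6⟩
  | add x y =>
    refine .store ⟨.refl _ _, _, ?_, hC⟩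
    simp only [Expr.eval, h.elem]
    exact h.setSet y 1 (a.elem x) _ (by simp) (fun k hk => by simp [hk])
  | del x y =>
    refine .store ⟨.refl _ _, _, ?_, hC⟩
    simp only [Expr.eval, h.elem]
    exact h.setSet y 0 (a.elem x) _ (by simp) (fun k hk => by simp [hk])
  | forE x C ih =>
    refine .seq (.assign ?_)
    refine .seq (.countTo n hB (h.setScratch _ _).size (by omega)
      (fun i s1 => SameBelow d s s1 ∧ s1.var (3 * d + 4) = e (a.elem x) ∧
        ∃ b, Represents e K s1 b ∧ ((elemList e).drop i).foldr
          (fun g Ψ b => wp e K B C Ψ (b.setElem x g))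
          (fun b => Φ (b.setElem x (a.elem x))) b) ?_ ?_ ?_)
    · refine ⟨((SameBelow.refl _ _).setScratch le_rfl).setScratch (by omega), ?_, a,
        (h.setScratch _ _).setScratch _ _, hC⟩
      simp [Expr.eval, h.elem]
    · rintro i hi s1 h1 h2 ⟨h3, h4, b, h5, h6⟩
      rw [elemList_drop hi, List.foldr_cons] at h6
      refine .seq (.assign ?_)
      simp only [Expr.eval, h1]
      have h7 := h5.setElem x (e.symm ⟨i, hi⟩)
      rw [Equiv.apply_symm_apply] at h7
      refine (ih (d + 2) h7 h6).mono ?_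
      rintro s2 ⟨h8, b', h9, h10⟩
      have h11 := ((SameBelow.refl (d + 2) s1).setElem (x := x) (v := i)).trans h8
      refine ⟨?_, h9.size, (h3.trans (h11.mono (by omega))).setScratch (by omega), ?_, b',
        h9.setScratch _ _, h10⟩
      · rw [h11 (d + 1) (by omega), h1]
      · rw [State.setVar_var, if_neg (by omega), h11 d (by omega), h4]
    · rintro s1 ⟨h3, h4, b, h5, h6⟩
      rw [elemList_drop_length] at h6
      refine .assign ⟨h3.setElem, _, ?_, h6⟩
      simpa [Expr.eval, h4] using h5.setElem x (a.elem x)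
  | rep C ih =>
    refine .countTo K hK h.iter (by omega)
      (fun i s1 => SameBelow d s s1 ∧
        ∃ b, Represents e K s1 b ∧ (wp e K B C)^[K - i] Φ b) ?_ ?_ ?_
    · exact ⟨(SameBelow.refl _ _).setScratch le_rfl, a, h.setScratch _ _, hC⟩
    · rintro i hi s1 h1 h2 ⟨h3, b, h5, h6⟩
      rw [show K - i = (K - (i + 1)) + 1 by omega, Function.iterate_succ_apply'] at h6
      refine (ih (d + 1) h5 h6).mono ?_
      rintro s2 ⟨h8, b', h9, h10⟩
      exact ⟨by rw [h8 d (by omega), h1], h9.iter,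
        (h3.trans (h8.mono (by omega))).setScratch le_rfl, b', h9.setScratch _ _, h10⟩
    · rintro s1 ⟨h3, b, h5, h6⟩
      rw [Nat.sub_self] at h6
      exact ⟨h3, b, h5, h6⟩
  | forL l x C ih =>
    -- Positivity makes `i * n < length * n` strict, so that the loop test does not fail too early.
    have hn : 0 < n := (Nat.zero_le _).trans_lt (e 1).2
    obtain ⟨hlen, hC⟩ := hC
    refine .seq (.assign (.loop (a.list l).length hlen
      (fun i s1 => SameBelow d s s1 ∧ s1.var (3 * d + 4) = i * n ∧
        ∃ b, Represents e K s1 b ∧ ((a.list l).drop i).foldr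
          (fun S Ψ b => b.list l = a.list l ∧ wp e K B C Ψ (b.setSet x S))
          (fun b => b.list l = a.list l ∧ Φ b) b) ?_ ?_ ?_))
    · exact ⟨(SameBelow.refl _ _).setScratch le_rfl, by simp [Expr.eval], a,
        h.setScratch _ _, hC⟩
    · rintro i hi s1 ⟨h3, h4, b, h5, h6⟩
      rw [List.drop_eq_getElem_cons hi, List.foldr_cons] at h6
      obtain ⟨hbl, h6⟩ := h6
      refine ⟨?_, .seq ((h5.runs_load hB x (i := i) (by rw [hbl]; exact hi) h4).mono ?_)⟩
      · simp only [Expr.eval, h5.len, h4, hbl]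
        have := (Nat.mul_lt_mul_right hn).2 hi
        omega
      rintro s2 ⟨h7, h8⟩
      have h9 : (b.list l)[i]'(by rw [hbl]; exact hi) = (a.list l)[i] := by simp only [hbl]
      rw [h9] at h7
      refine .seq ((ih (d + 1) h7 h6).mono ?_)
      rintro s3 ⟨h10, b', h11, h12⟩
      have h13 := h8.trans h10
      refine .assign ⟨(h3.trans (h13.mono (by omega))).setScratch le_rfl, ?_, b',
        h11.setScratch _ _, h12⟩
      simp only [Expr.eval, State.setVar_var, if_true, h11.size]
      rw [h13 d (by omega), h4]
      ring
    · rintro s1 ⟨h3, h4, b, h5, h6⟩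
      rw [List.drop_length] at h6
      exact ⟨by simp [Expr.eval, h5.len, h4, h6.1], h3, b, h5, h6.2⟩
  | push l x =>
    exact (h.runs_push hB l x d).mono fun s' h' => ⟨h'.1, _, h'.2, hC⟩
  | nil l =>
    refine .assign ⟨(SameBelow.refl _ _).setLen, _, ?_, hC⟩
    exact
      { size := by rw [State.setVar_var, if_neg (by omega), h.size]
        iter := by rw [State.setVar_var, if_neg (by omega), h.iter]
        table := h.table
        offset := h.offset
        elem := fun y => by rw [State.setVar_var, if_neg (by omega), h.elem]; rfl
        set := h.set
        len := fun l' => by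
          by_cases hl : l' = l
          · subst hl; simp [Expr.eval]
          · rw [State.setVar_var, if_neg (by omega), h.len]; simp [hl]
        row := fun l' i hi g => by
          by_cases hl : l' = l
          · subst hl; simp at hi
          · simp only [AState.setList_list, Function.update_of_ne hl] at hi ⊢
            exact h.row l' i hi g
        out := h.out }
  | emit x =>
    exact (h.runs_emit hB x d).mono fun s' h' => ⟨h'.1, _, h'.2, hC⟩

end

/-! ## Cyclic and simple sections of a finite group -/

section

open scoped commutatorElement

variable {G : Type*} [Group G]

/-- `N` is a normal subgroup of `H`. -/
def NormalIn (N H : Subgroup G) : Prop :=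
  N ≤ H ∧ ∀ h ∈ H, ∀ x ∈ N, h * x * h⁻¹ ∈ N

/-- `N` is normal in `H` with cyclic quotient. -/
def CyclicIn (N H : Subgroup G) : Prop :=
  NormalIn N H ∧ ∃ x ∈ H, H ≤ N ⊔ Subgroup.zpowers x

/-- `N` is normal in `H` with simple quotient. -/
def SimpleIn (N H : Subgroup G) : Prop :=
  NormalIn N H ∧ N ≠ H ∧ ∀ K, NormalIn K H → N ≤ K → K = N ∨ K = H

/-- The smallest subgroup that contains `S` and is invariant under conjugation by `H`. -/
def ncl (H : Subgroup G) (S : Set G) : Subgroup G :=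
  sInf {K | S ⊆ K ∧ ∀ h ∈ H, ∀ x ∈ K, h * x * h⁻¹ ∈ K}

variable {H N K P Q : Subgroup G} {S : Set G}

theorem subset_ncl : S ⊆ ncl H S := fun x hx => by
  simp only [ncl, SetLike.mem_coe, Subgroup.mem_sInf]
  exact fun K hK => hK.1 hx

theorem conj_mem_ncl {h x : G} (hh : h ∈ H) (hx : x ∈ ncl H S) : h * x * h⁻¹ ∈ ncl H S := by
  simp only [ncl, Subgroup.mem_sInf] at hx ⊢
  exact fun K hK => hK.2 h hh x (hx K hK)

theorem ncl_le (hS : S ⊆ K) (hK : ∀ h ∈ H, ∀ x ∈ K, h * x * h⁻¹ ∈ K) : ncl H S ≤ K :=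
  sInf_le ⟨hS, hK⟩

theorem normalIn_self (H : Subgroup G) : NormalIn H H :=
  ⟨le_rfl, fun _ hh _ hx => H.mul_mem (H.mul_mem hh hx) (H.inv_mem hh)⟩

theorem normalIn_ncl (hS : S ⊆ H) : NormalIn (ncl H S) H :=
  ⟨ncl_le hS (normalIn_self H).2, fun _ hh _ hx => conj_mem_ncl hh hx⟩

theorem ncl_eq_self (hN : NormalIn N H) : ncl H (N : Set G) = N :=
  le_antisymm (ncl_le subset_rfl hN.2) subset_ncl

theorem ncl_insert_le {y : G} (hK : NormalIn K H) (hN : N ≤ K) (hy : y ∈ K) :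
    ncl H (insert y (N : Set G)) ≤ K :=
  ncl_le (Set.insert_subset hy hN) hK.2

theorem le_ncl_insert {y : G} : N ≤ ncl H (insert y (N : Set G)) :=
  fun _ hx => subset_ncl (Set.mem_insert_of_mem _ hx)

theorem mem_ncl_insert {y : G} : y ∈ ncl H (insert y S) :=
  subset_ncl (Set.mem_insert _ _)

/-- In a finite group inverses are powers, so the closure computation never has to form inverses. -/
theorem ncl_eq_of_closed [Finite G] {T : Set G} (hST : S ⊆ T) (hT : T ⊆ ncl H S)
    (h1 : 1 ∈ T) (hmul : ∀ x ∈ T, ∀ y ∈ T, x * y ∈ T)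
    (hconj : ∀ h ∈ H, ∀ x ∈ T, h * x * h⁻¹ ∈ T) : T = ncl H S := by
  let M : Submonoid G := ⟨⟨T, fun {x y} hx hy => hmul x hx y hy⟩, h1⟩
  let K : Subgroup G := { M with
    inv_mem' := fun {x} hx => by
      have hx' : x ∈ M := hx
      have h := M.pow_mem hx' (orderOf x - 1)
      have h2 : x⁻¹ = x ^ (orderOf x - 1) := by
        rw [inv_eq_iff_mul_eq_one, ← pow_succ', Nat.sub_add_cancel (orderOf_pos x),
          pow_orderOf_eq_one]
      change x⁻¹ ∈ M
      rwa [h2] }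
  exact Set.Subset.antisymm hT (ncl_le (K := K) hST hconj)

theorem normalIn_of_commutator_le (h1 : ⁅H, H⁆ ≤ N) (h2 : N ≤ H) : NormalIn N H := by
  refine ⟨h2, fun h hh x hx => ?_⟩
  have : h * x * h⁻¹ = ⁅h, x⁆ * x := by simp [commutatorElement_def]
  rw [this]
  exact N.mul_mem (h1 (Subgroup.commutator_mem_commutator hh (h2 hx))) hx

/-- Every subgroup between the commutator subgroup and `H` is normal in `H`, so conjugation adds
nothing to the join. -/
theorem ncl_insert_eq_sup {y : G} (h1 : ⁅H, H⁆ ≤ N) (h2 : N ≤ H) (hy : y ∈ H) :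
    ncl H (insert y (N : Set G)) = N ⊔ Subgroup.zpowers y := by
  have hle : N ⊔ Subgroup.zpowers y ≤ H := sup_le h2 (by simpa using hy)
  refine le_antisymm (ncl_insert_le (normalIn_of_commutator_le (h1.trans le_sup_left) hle)
    le_sup_left ?_) (sup_le le_ncl_insert ?_)
  · exact (le_sup_right : _ ≤ N ⊔ _) (Subgroup.mem_zpowers y)
  · simpa using mem_ncl_insert

/-- The equation `a * b = g * (b * a)` says that `g` is the commutator of `a` and `b` without
inverses, as formulas require. -/
theorem ncl_commutators :
    ncl H {g | ∃ a ∈ H, ∃ b ∈ H, a * b = g * (b * a)} = ⁅H, H⁆ := by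
  have key : ∀ a b g : G, a * b = g * (b * a) ↔ g = ⁅a, b⁆ := by
    intro a b g
    rw [commutatorElement_def, ← mul_inv_eq_iff_eq_mul, mul_inv_rev, eq_comm]
    simp [mul_assoc]
  refine le_antisymm (ncl_le ?_ ?_) ?_
  · rintro g ⟨a, ha, b, hb, h⟩
    rw [(key a b g).1 h]
    exact Subgroup.commutator_mem_commutator ha hb
  · exact (normalIn_of_commutator_le le_rfl
      ((Subgroup.commutator_le).2 fun a ha b hb =>
        H.mul_mem (H.mul_mem (H.mul_mem ha hb) (H.inv_mem ha)) (H.inv_mem hb))).2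
  · exact Subgroup.commutator_le.2 fun a ha b hb =>
      subset_ncl ⟨a, ha, b, hb, (key a b _).2 rfl⟩

/-! ### Cyclic quotients -/

theorem normalIn_iff : NormalIn N H ↔ N ≤ H ∧ (N.subgroupOf H).Normal := by
  refine and_congr_right fun _ => ⟨fun h => ⟨?_⟩, fun h x hx y hy => ?_⟩
  · rintro ⟨x, hx⟩ hxN ⟨g, hg⟩
    exact h g hg x hxN
  · by_cases hyH : y ∈ H
    · exact h.conj_mem ⟨y, hyH⟩ hy ⟨x, hx⟩
    · exact absurd (‹N ≤ H› hy) hyH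

theorem isCyclic_quotient_iff (hN : N ≤ H) [(N.subgroupOf H).Normal] :
    IsCyclic (H ⧸ N.subgroupOf H) ↔ ∃ x ∈ H, H ≤ N ⊔ Subgroup.zpowers x := by
  constructor
  · rintro ⟨q, hq⟩
    obtain ⟨⟨x, hx⟩, rfl⟩ := QuotientGroup.mk_surjective q
    refine ⟨x, hx, fun h hh => ?_⟩
    obtain ⟨i, hi⟩ := hq (QuotientGroup.mk ⟨h, hh⟩)
    have hi' : ((⟨x, hx⟩ ^ i : H) : H ⧸ N.subgroupOf H) = (⟨h, hh⟩ : H) := hi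
    rw [QuotientGroup.eq] at hi'
    have hn : (x ^ i)⁻¹ * h ∈ N := by simpa [Subgroup.mem_subgroupOf] using hi'
    have : h = x ^ i * ((x ^ i)⁻¹ * h) := by group
    rw [this]
    exact mul_mem ((le_sup_right : _ ≤ N ⊔ _) (Subgroup.zpow_mem_zpowers x i))
      ((le_sup_left : N ≤ _) hn)
  · rintro ⟨x, hx, hH⟩
    refine ⟨⟨QuotientGroup.mk ⟨x, hx⟩, fun q => ?_⟩⟩
    obtain ⟨⟨h, hh⟩, rfl⟩ := QuotientGroup.mk_surjective q
    -- The elements of `H` whose class is a power of the class of `x`, as a subgroup of `G`.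
    let L : Subgroup G := ((Subgroup.zpowers (QuotientGroup.mk ⟨x, hx⟩ : H ⧸ N.subgroupOf H)).comap
      (QuotientGroup.mk' _)).map H.subtype
    have hL : N ⊔ Subgroup.zpowers x ≤ L := by
      refine sup_le (fun y hy => ⟨⟨y, hN hy⟩, ?_, rfl⟩) ?_
      · have : (QuotientGroup.mk ⟨y, hN hy⟩ : H ⧸ N.subgroupOf H) = 1 :=
          (QuotientGroup.eq_one_iff _).2 hy
        simp [this]
      · rw [Subgroup.zpowers_le]
        exact ⟨⟨x, hx⟩, by simp, rfl⟩
    obtain ⟨⟨h', hh'⟩, h1, rfl⟩ := hL (hH hh)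
    exact h1

theorem CyclicIn.commutator_le (h : CyclicIn N H) : ⁅H, H⁆ ≤ N := by
  obtain ⟨h1, h2⟩ := normalIn_iff.1 h.1
  have := (isCyclic_quotient_iff h1).2 h.2
  have hcomm := IsCyclic.isMulCommutative (α := H ⧸ N.subgroupOf H)
  refine Subgroup.commutator_le.2 fun a ha b hb => ?_
  have h3 : (QuotientGroup.mk ⁅(⟨a, ha⟩ : H), (⟨b, hb⟩ : H)⁆ : H ⧸ N.subgroupOf H) = 1 := by
    change QuotientGroup.mk' (N.subgroupOf H) _ = 1
    rw [map_commutatorElement, commutatorElement_eq_one_iff_mul_comm]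
    exact hcomm.is_comm.comm _ _
  rw [QuotientGroup.eq_one_iff] at h3
  exact h3

/-- The image of `P` in the cyclic group `H/N` is again cyclic; `y` is a preimage in `P` of a
generator. -/
theorem CyclicIn.exists_le_sup (h : CyclicIn N H) (hP : P ≤ H) :
    ∃ y ∈ P, P ≤ (N ⊓ P) ⊔ Subgroup.zpowers y := by
  obtain ⟨h1, h2⟩ := normalIn_iff.1 h.1
  have := (isCyclic_quotient_iff h1).2 h.2
  obtain ⟨⟨_, y, hy, rfl⟩, hq⟩ := (inferInstance : IsCyclic
    ((P.subgroupOf H).map (QuotientGroup.mk' (N.subgroupOf H))))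
  refine ⟨y, hy, fun p hp => ?_⟩
  obtain ⟨i, hi⟩ := hq ⟨_, ⟨p, hP hp⟩, hp, rfl⟩
  have hi' : ((y ^ i : H) : H ⧸ N.subgroupOf H) = (⟨p, hP hp⟩ : H) := congrArg Subtype.val hi
  rw [QuotientGroup.eq] at hi'
  have hn : ((y : G) ^ i)⁻¹ * p ∈ N := by simpa [Subgroup.mem_subgroupOf] using hi'
  have hy' : (y : G) ∈ P := hy
  have : p = (y : G) ^ i * (((y : G) ^ i)⁻¹ * p) := by group
  rw [this]
  exact mul_mem ((le_sup_right : _ ≤ (N ⊓ P) ⊔ _) (Subgroup.zpow_mem_zpowers _ i))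
    ((le_sup_left : N ⊓ P ≤ _) ⟨hn, P.mul_mem (P.inv_mem (P.zpow_mem hy' i)) hp⟩)

theorem CyclicIn.inf (h : CyclicIn N H) (hP : P ≤ H) : CyclicIn (N ⊓ P) P := by
  refine ⟨⟨inf_le_right, fun p hp x hx => ⟨h.1.2 p (hP hp) x hx.1, ?_⟩⟩, h.exists_le_sup hP⟩
  exact (normalIn_self P).2 p hp x hx.2

/-- The quotient of `Q ⊔ zpowers g` by `Q` is cyclic, hence so is the image in it of the
intersection with `N`. This lets the enumeration pass from `N ⊓ Q` to the next intersection by a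
single element. -/
theorem exists_inf_sup_eq (N : Subgroup G) (h1 : ⁅H, H⁆ ≤ Q) (h2 : Q ≤ H) {g : G}
    (hg : g ∈ H) : ∃ y ∈ Q ⊔ Subgroup.zpowers g,
      N ⊓ (Q ⊔ Subgroup.zpowers g) = (N ⊓ Q) ⊔ Subgroup.zpowers y := by
  have hle : Q ⊔ Subgroup.zpowers g ≤ H := sup_le h2 (by simpa using hg)
  have hQ : CyclicIn Q (Q ⊔ Subgroup.zpowers g) :=
    ⟨⟨le_sup_left, fun k hk => (normalIn_of_commutator_le h1 h2).2 k (hle hk)⟩, g,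
      (le_sup_right : _ ≤ Q ⊔ _) (Subgroup.mem_zpowers g), le_rfl⟩
  obtain ⟨y, hy, hP⟩ := hQ.exists_le_sup (P := N ⊓ (Q ⊔ Subgroup.zpowers g)) inf_le_right
  refine ⟨y, hy.2, le_antisymm (hP.trans (sup_le_sup_right ?_ _)) (sup_le ?_ ?_)⟩
  · exact le_inf (inf_le_right.trans inf_le_left) inf_le_left
  · exact inf_le_inf le_rfl le_sup_left
  · simpa using hy

/-! ### Simple quotients -/

theorem SimpleIn.cyclicIn_of_commutator_le (h : SimpleIn N H) (h1 : ⁅H, H⁆ ≤ N) :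
    CyclicIn N H := by
  have hNH := h.1.1
  obtain ⟨x, hx, hxN⟩ := SetLike.exists_of_lt (lt_of_le_of_ne hNH h.2.1)
  refine ⟨h.1, x, hx, ?_⟩
  have hle : N ⊔ Subgroup.zpowers x ≤ H := sup_le hNH (by simpa using hx)
  rcases h.2.2 _ (normalIn_of_commutator_le (h1.trans le_sup_left) hle) le_sup_left with h2 | h2
  · exact absurd (h2.le ((le_sup_right : _ ≤ N ⊔ _) (Subgroup.mem_zpowers x))) hxN
  · exact h2.ge

theorem SimpleIn.ncl_insert (h : SimpleIn N H) {y : G} (hy : y ∈ H) (hyN : y ∉ N) :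
    ncl H (insert y (N : Set G)) = H := by
  rcases h.2.2 _ (normalIn_ncl (Set.insert_subset hy h.1.1)) le_ncl_insert with h2 | h2
  · exact absurd (h2 ▸ mem_ncl_insert) hyN
  · exact h2

/-- The elements of `H` whose normal closure in `H` does not contain `x`. -/
def avoiding (H : Subgroup G) (x : G) : Set G := {y | y ∈ H ∧ x ∉ ncl H {y}}

/-- The product of the normal closure of `x` with `N` is normal in `H` and strictly larger than `N`,
so it is `H`. -/
theorem SimpleIn.exists_mul (h : SimpleIn N H) {x a : G} (hx : x ∈ H) (hxN : x ∉ N)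
    (ha : a ∈ H) : ∃ u ∈ ncl H {x}, ∃ m ∈ N, a = u * m := by
  have hn := normalIn_ncl (H := H) (S := {x}) (by simpa using hx)
  let K : Subgroup G :=
    { carrier := {a | ∃ u ∈ ncl H {x}, ∃ m ∈ N, a = u * m}
      one_mem' := ⟨1, one_mem _, 1, one_mem _, by simp⟩
      mul_mem' := by
        rintro _ _ ⟨u, hu, m, hm, rfl⟩ ⟨v, hv, k, hk, rfl⟩
        exact ⟨u * v, mul_mem hu hv, v⁻¹ * m * v * k,
          mul_mem (by simpa using h.1.2 v⁻¹ (H.inv_mem (hn.1 hv)) m hm) hk, by group⟩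
      inv_mem' := by
        rintro _ ⟨u, hu, m, hm, rfl⟩
        exact ⟨u⁻¹, inv_mem hu, u * m⁻¹ * u⁻¹, h.1.2 u (hn.1 hu) _ (inv_mem hm), by group⟩ }
  have hNK : N ≤ K := fun m hm => ⟨1, one_mem _, m, hm, by simp⟩
  have hxK : x ∈ K := ⟨x, subset_ncl rfl, 1, one_mem _, by simp⟩
  have hK : NormalIn K H := by
    refine ⟨?_, ?_⟩
    · rintro _ ⟨u, hu, m, hm, rfl⟩
      exact mul_mem (hn.1 hu) (h.1.1 hm)
    · rintro k hk _ ⟨u, hu, m, hm, rfl⟩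
      exact ⟨k * u * k⁻¹, hn.2 k hk u hu, k * m * k⁻¹, h.1.2 k hk m hm, by group⟩
  rcases h.2.2 K hK hNK with h2 | h2
  · exact absurd (h2 ▸ hxK) hxN
  · exact (h2 ▸ ha : a ∈ K)

/-- Take two elements of `H` whose commutator is outside `N` and move them modulo `N` into the
normal closures of `x` and `y`. The commutator of the new elements lies in both closures and agrees
with the old one modulo `N`. -/
theorem SimpleIn.exists_mem_ncl_inf (h : SimpleIn N H) (h1 : ¬ ⁅H, H⁆ ≤ N) {x y : G}
    (hx : x ∈ H) (hxN : x ∉ N) (hy : y ∈ H) (hyN : y ∉ N) :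
    ∃ z ∈ ncl H {x}, z ∈ ncl H {y} ∧ z ∉ N := by
  rw [Subgroup.commutator_le] at h1
  push Not at h1
  obtain ⟨a, ha, b, hb, hab⟩ := h1
  obtain ⟨u, hu, m, hm, rfl⟩ := h.exists_mul hx hxN ha
  obtain ⟨v, hv, k, hk, rfl⟩ := h.exists_mul hy hyN hb
  have hnx := normalIn_ncl (H := H) (S := {x}) (by simpa using hx)
  have hny := normalIn_ncl (H := H) (S := {y}) (by simpa using hy)
  refine ⟨⁅u, v⁆, ?_, ?_, fun huv => hab ?_⟩
  · rw [commutatorElement_def, mul_assoc, mul_assoc, ← mul_assoc v]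
    exact mul_mem hu (hnx.2 v (hny.1 hv) _ (inv_mem hu))
  · rw [commutatorElement_def]
    exact mul_mem (hny.2 u (hnx.1 hu) _ hv) (inv_mem hv)
  · obtain ⟨h3, h4⟩ := normalIn_iff.1 h.1
    have key : ∀ (a : G) (ha : a ∈ H), a ∈ N ↔
        (QuotientGroup.mk' (N.subgroupOf H)) ⟨a, ha⟩ = 1 := fun a ha => by
      rw [QuotientGroup.mk'_apply, QuotientGroup.eq_one_iff, Subgroup.mem_subgroupOf]
    have huH := hnx.1 hu
    have hvH := hny.1 hv
    have hmH := h3 hm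
    have hkH := h3 hk
    have e1 : (QuotientGroup.mk' (N.subgroupOf H)) ⟨m, hmH⟩ = 1 := (key m hmH).1 hm
    have e2 : (QuotientGroup.mk' (N.subgroupOf H)) ⟨k, hkH⟩ = 1 := (key k hkH).1 hk
    have h5 : (QuotientGroup.mk' (N.subgroupOf H)) ⁅(⟨u, huH⟩ : H), (⟨v, hvH⟩ : H)⁆ = 1 :=
      (key _ (⁅(⟨u, huH⟩ : H), (⟨v, hvH⟩ : H)⁆).2).1 huv
    refine (key _ (⁅(⟨u, huH⟩ * ⟨m, hmH⟩ : H), (⟨v, hvH⟩ * ⟨k, hkH⟩ : H)⁆).2).2 ?_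
    refine Eq.trans ?_ h5
    change (QuotientGroup.mk' (N.subgroupOf H))
      ⁅(⟨u, huH⟩ * ⟨m, hmH⟩ : H), (⟨v, hvH⟩ * ⟨k, hkH⟩ : H)⁆ = _
    rw [map_commutatorElement, map_commutatorElement, map_mul, map_mul, e1, e2, mul_one, mul_one]

theorem SimpleIn.eq_avoiding [Finite G] (h : SimpleIn N H) (h1 : ¬ ⁅H, H⁆ ≤ N) :
    ∃ x ∈ H, (N : Set G) = avoiding H x := by
  obtain ⟨x0, hx0⟩ := SetLike.exists_of_lt (lt_of_le_of_ne h.1.1 h.2.1)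
  -- Minimality forces each element of the closure of `x` outside `N` to have the same closure as
  -- `x`.
  obtain ⟨x, ⟨hx, hxN⟩, hmin⟩ := Set.exists_min_image {x | x ∈ H ∧ x ∉ N}
    (fun x => Nat.card (ncl H {x})) (Set.toFinite _) ⟨x0, hx0⟩
  refine ⟨x, hx, Set.ext fun y => ⟨fun hy => ⟨h.1.1 hy, fun hxy => hxN ?_⟩, ?_⟩⟩
  · exact ncl_le (by simpa using hy) h.1.2 hxy
  · rintro ⟨hyH, hxy⟩
    by_contra hyN
    obtain ⟨z, hzx, hzy, hzN⟩ := h.exists_mem_ncl_inf h1 hx hxN hyH hyN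
    have hnx := normalIn_ncl (H := H) (S := {x}) (by simpa using hx)
    have hny := normalIn_ncl (H := H) (S := {y}) (by simpa using hyH)
    have h2 : ncl H {z} ≤ ncl H {x} := ncl_le (by simpa using hzx) hnx.2
    have h3 : ncl H {z} = ncl H {x} :=
      Subgroup.eq_of_le_of_card_ge h2 (hmin z ⟨hnx.1 hzx, hzN⟩)
    have h4 : ncl H {z} ≤ ncl H {y} := ncl_le (by simpa using hzy) hny.2
    exact hxy (h4 (h3 ▸ subset_ncl rfl))

/-- Since `x` lies in its own closure it is not in `N`, so `N` is proper. A normal `K` above `N`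
with an element outside `N` contains the closure generated by `N` and that element, which is `H`. -/
theorem simpleIn_of_avoiding {x : G} (hx : x ∈ H) (hN : (N : Set G) = avoiding H x)
    (hNH : NormalIn N H) (h : ∀ y ∈ H, y ∈ N ∨ ncl H (insert y (N : Set G)) = H) :
    SimpleIn N H := by
  refine ⟨hNH, ?_, fun K hK hle => ?_⟩
  · rintro rfl
    have : x ∈ avoiding N x := hN ▸ hx
    exact this.2 (subset_ncl rfl)
  · by_cases hKN : K ≤ N
    · exact .inl (le_antisymm hKN hle)
    · obtain ⟨y, hy, hyN⟩ := SetLike.not_le_iff_exists.1 hKN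
      refine .inr (le_antisymm hK.1 ?_)
      rw [← (h y (hK.1 hy)).resolve_left hyN]
      exact ncl_insert_le hK hle hy

end

section

open scoped commutatorElement

/-! ## Counting -/

variable {G : Type*} [Group G] {H N : Subgroup G}

/-- `N` is normal in `H` with cyclic or simple quotient. -/
def SectionStep (H N : Subgroup G) : Prop := CyclicIn N H ∨ SimpleIn N H

/-- The subgroups reached from `G` by descending series of length `i` with cyclic or simple
factors. -/
def seriesLevel (G : Type*) [Group G] : ℕ → Set (Subgroup G)
  | 0 => {⊤}
  | i + 1 => {N | ∃ H ∈ seriesLevel G i, SectionStep H N}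

/-- A finite cyclic group is isomorphic to the complex roots of unity of its order. -/
theorem exists_unit_character [Finite G] (h : CyclicIn N H) :
    ∃ χ : H →* ℂˣ, χ.ker = N.subgroupOf H := by
  obtain ⟨h1, h2⟩ := normalIn_iff.1 h.1
  have := (isCyclic_quotient_iff h1).2 h.2
  have hne : NeZero (Nat.card (H ⧸ N.subgroupOf H)) := ⟨Nat.card_pos.ne'⟩
  let f := mulEquivOfCyclicCardEq (G := H ⧸ N.subgroupOf H)
    (G' := rootsOfUnity (Nat.card (H ⧸ N.subgroupOf H)) ℂ) (Complex.card_rootsOfUnity _).symm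
  refine ⟨(Subgroup.subtype _).comp (f.toMonoidHom.comp (QuotientGroup.mk' _)), ?_⟩
  ext x
  simp [MonoidHom.mem_ker]

theorem ncard_cyclicIn_le [Finite G] (H : Subgroup G) :
    {N | CyclicIn N H}.ncard ≤ Nat.card G := by
  -- Characters factor through the abelianization, and a finite abelian group has as many characters
  -- as elements.
  have hcard : Nat.card (H →* ℂˣ) = Nat.card (Abelianization H) := by
    rw [Nat.card_congr Abelianization.lift,
      CommGroup.card_monoidHom_of_hasEnoughRootsOfUnity (Abelianization H) ℂ]
  have hfin : Finite (H →* ℂˣ) := Nat.finite_of_card_ne_zero (by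
    rw [hcard]; exact Nat.card_pos.ne')
  choose χ hχ using fun N : {N | CyclicIn N H} => exists_unit_character N.2
  have hinj : Function.Injective χ := by
    intro N N' hNN
    have h1 : (N : Subgroup G).subgroupOf H = (N' : Subgroup G).subgroupOf H := by
      rw [← hχ, ← hχ, hNN]
    rw [Subgroup.subgroupOf_inj, inf_eq_left.2 N.2.1.1, inf_eq_left.2 N'.2.1.1] at h1
    exact Subtype.ext h1
  calc {N | CyclicIn N H}.ncard = Nat.card {N | CyclicIn N H} := rfl
    _ ≤ Nat.card (H →* ℂˣ) := Nat.card_le_card_of_injective χ hinj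
    _ = Nat.card (Abelianization H) := hcard
    _ ≤ Nat.card H := Nat.card_le_card_of_surjective _ (QuotientGroup.mk'_surjective _)
    _ ≤ Nat.card G := Subgroup.card_le_card_group H

/-- Characters account for the cyclic quotients, abelian simple ones included; the remaining
subgroups are values of `avoiding H`, a function on `G`. -/
theorem ncard_sectionStep_le [Finite G] (H : Subgroup G) :
    {N | SectionStep H N}.ncard ≤ 2 * Nat.card G := by
  have hsub : {N | SectionStep H N} ⊆ {N | CyclicIn N H} ∪
      {N | (N : Set G) ∈ Set.range (avoiding H)} := by
    rintro N (hN | hN)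
    · exact .inl hN
    · by_cases hc : ⁅H, H⁆ ≤ N
      · exact .inl (hN.cyclicIn_of_commutator_le hc)
      · obtain ⟨x, -, hx⟩ := hN.eq_avoiding hc
        exact .inr ⟨x, hx.symm⟩
  have h2 : {N : Subgroup G | (N : Set G) ∈ Set.range (avoiding H)}.ncard ≤ Nat.card G := by
    calc _ ≤ (Set.range (avoiding H)).ncard :=
          Set.ncard_le_ncard_of_injOn (fun N : Subgroup G => (N : Set G)) (fun N hN => hN)
            (fun _ _ _ _ h => SetLike.coe_injective h) (Set.toFinite _)
      _ ≤ (Set.univ : Set G).ncard := by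
          rw [← Set.image_univ]; exact Set.ncard_image_le (Set.toFinite _)
      _ = Nat.card G := Set.ncard_univ G
  calc _ ≤ _ := Set.ncard_le_ncard hsub (Set.toFinite _)
    _ ≤ _ := Set.ncard_union_le _ _
    _ ≤ _ := by have := ncard_cyclicIn_le H; omega

theorem ncard_seriesLevel_le [Finite G] (i : ℕ) :
    (seriesLevel G i).ncard ≤ (2 * Nat.card G) ^ i := by
  classical
  induction i with
  | zero => simp [seriesLevel]
  | succ i ih =>
    let T : Finset (Subgroup G) := (Set.toFinite (seriesLevel G i)).toFinset
    let f : Subgroup G → Finset (Subgroup G) :=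
      fun H => (Set.toFinite {N | SectionStep H N}).toFinset
    have h1 : seriesLevel G (i + 1) = (T.biUnion f : Finset (Subgroup G)) := by
      ext N; simp [seriesLevel, T, f]
    rw [h1, Set.ncard_coe_finset, pow_succ]
    refine (Finset.card_biUnion_le_card_mul T f (2 * Nat.card G) fun H _ => ?_).trans ?_
    · rw [← Set.ncard_eq_toFinset_card]
      exact ncard_sectionStep_le H
    · refine Nat.mul_le_mul_right _ ?_
      rw [← Set.ncard_eq_toFinset_card]
      exact ih

theorem List.length_le_of_subset_carriers [Finite G] {L : List (Set G)} (hL : L.Nodup)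
    {𝒮 : Set (Subgroup G)} (h : ∀ S ∈ L, ∃ N ∈ 𝒮, (N : Set G) = S) : L.length ≤ 𝒮.ncard := by
  classical
  rw [← List.toFinset_card_of_nodup hL, ← Set.ncard_coe_finset]
  refine (Set.ncard_le_ncard (t := (fun N : Subgroup G => (N : Set G)) '' 𝒮) ?_
    (Set.toFinite _)).trans (Set.ncard_image_le (Set.toFinite _))
  intro S hS
  exact h S (by simpa using hS)

/-! ## Series of quotients -/

theorem isSimpleGroup_quotient_iff (hN : N ≤ H) [hn : (N.subgroupOf H).Normal] :
    IsSimpleGroup (H ⧸ N.subgroupOf H) ↔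
      N ≠ H ∧ ∀ K, NormalIn K H → N ≤ K → K = N ∨ K = H := by
  constructor
  · intro hs
    refine ⟨?_, fun K hK hNK => ?_⟩
    · rintro rfl
      obtain ⟨a, b, hab⟩ := hs.exists_pair_ne
      obtain ⟨a, rfl⟩ := QuotientGroup.mk_surjective a
      obtain ⟨b, rfl⟩ := QuotientGroup.mk_surjective b
      exact hab (QuotientGroup.eq.2 (by simp))
    · have hKn := (normalIn_iff.1 hK).2
      have hmap : ((K.subgroupOf H).map (QuotientGroup.mk' (N.subgroupOf H))).Normal :=
        hKn.map _ (QuotientGroup.mk'_surjective _)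
      rcases hs.eq_bot_or_eq_top_of_normal _ hmap with h1 | h1
      · left
        refine le_antisymm (fun x hx => ?_) hNK
        have : QuotientGroup.mk' (N.subgroupOf H) ⟨x, hK.1 hx⟩ ∈
            (K.subgroupOf H).map (QuotientGroup.mk' (N.subgroupOf H)) := ⟨⟨x, hK.1 hx⟩, hx, rfl⟩
        rw [h1, Subgroup.mem_bot, QuotientGroup.mk'_apply, QuotientGroup.eq_one_iff] at this
        exact this
      · right
        refine le_antisymm hK.1 fun x hx => ?_
        have : QuotientGroup.mk' (N.subgroupOf H) ⟨x, hx⟩ ∈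
            (K.subgroupOf H).map (QuotientGroup.mk' (N.subgroupOf H)) := by rw [h1]; trivial
        obtain ⟨y, hy, hyx⟩ := this
        have h2 : y⁻¹ * ⟨x, hx⟩ ∈ N.subgroupOf H := QuotientGroup.eq.1 hyx
        have h3 : (y : G)⁻¹ * x ∈ K := hNK h2
        have h4 : (y : G) ∈ K := hy
        simpa using K.mul_mem h4 h3
  · rintro ⟨hne, hs⟩
    obtain ⟨x, hx, hxN⟩ := SetLike.exists_of_lt (lt_of_le_of_ne hN hne)
    refine { exists_pair_ne := ⟨QuotientGroup.mk ⟨x, hx⟩, 1, ?_⟩,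
             eq_bot_or_eq_top_of_normal := fun L hL => ?_ }
    · rw [Ne, QuotientGroup.eq_one_iff]
      exact hxN
    · have hLn : (L.comap (QuotientGroup.mk' (N.subgroupOf H))).Normal := inferInstance
      have hmem : ∀ y (hy : y ∈ H),
          y ∈ (L.comap (QuotientGroup.mk' (N.subgroupOf H))).map H.subtype ↔
          (QuotientGroup.mk ⟨y, hy⟩ : H ⧸ N.subgroupOf H) ∈ L := by
        intro y hy
        simp [hy]
      have hnorm : NormalIn ((L.comap (QuotientGroup.mk' (N.subgroupOf H))).map H.subtype) H := by
        refine ⟨Subgroup.map_subtype_le _, ?_⟩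
        rintro h hh _ ⟨⟨y, hy⟩, hyL, rfl⟩
        exact ⟨⟨h, hh⟩ * ⟨y, hy⟩ * ⟨h, hh⟩⁻¹, hLn.conj_mem _ hyL ⟨h, hh⟩, rfl⟩
      have hle : N ≤ (L.comap (QuotientGroup.mk' (N.subgroupOf H))).map H.subtype := by
        intro y hy
        rw [hmem y (hN hy)]
        have : (QuotientGroup.mk ⟨y, hN hy⟩ : H ⧸ N.subgroupOf H) = 1 :=
          (QuotientGroup.eq_one_iff _).2 hy
        rw [this]
        exact one_mem _
      rcases hs _ hnorm hle with h1 | h1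
      · left
        rw [eq_bot_iff]
        intro q hq
        obtain ⟨⟨y, hy⟩, rfl⟩ := QuotientGroup.mk_surjective q
        rw [Subgroup.mem_bot, QuotientGroup.eq_one_iff]
        exact h1 ▸ (hmem y hy).2 hq
      · right
        rw [eq_top_iff]
        intro q _
        obtain ⟨⟨y, hy⟩, rfl⟩ := QuotientGroup.mk_surjective q
        exact (hmem y hy).1 (h1.ge hy)

theorem sectionStep_iff : SectionStep H N ↔ N ≤ H ∧ ∃ _ : (N.subgroupOf H).Normal,
    IsCyclicOrSimple (H ⧸ N.subgroupOf H) := by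
  constructor
  · rintro (h | h)
    · obtain ⟨h1, h2⟩ := normalIn_iff.1 h.1
      exact ⟨h1, h2, .inl ((isCyclic_quotient_iff h1).2 h.2)⟩
    · obtain ⟨h1, h2⟩ := normalIn_iff.1 h.1
      exact ⟨h1, h2, .inr ((isSimpleGroup_quotient_iff h1).2 h.2)⟩
  · rintro ⟨h1, h2, h3 | h3⟩
    · exact .inl ⟨normalIn_iff.2 ⟨h1, h2⟩, (isCyclic_quotient_iff h1).1 h3⟩
    · exact .inr ⟨normalIn_iff.2 ⟨h1, h2⟩, (isSimpleGroup_quotient_iff h1).1 h3⟩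

theorem normalIn_comap_iff {G' : Type*} [Group G'] {f : G →* G'} (hf : Function.Surjective f)
    {H' N' : Subgroup G'} : NormalIn (N'.comap f) (H'.comap f) ↔ NormalIn N' H' := by
  refine and_congr (Subgroup.comap_le_comap_of_surjective hf) ⟨fun h => ?_, fun h => ?_⟩
  · intro a ha x hx
    obtain ⟨a, rfl⟩ := hf a
    obtain ⟨x, rfl⟩ := hf x
    simpa using h a ha x hx
  · intro a ha x hx
    simpa using h (f a) ha (f x) hx

/-- The correspondence theorem, with both kinds of step phrased through subgroups only, so that no
quotient of a quotient occurs. -/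
theorem sectionStep_comap_iff {G' : Type*} [Group G'] {f : G →* G'}
    (hf : Function.Surjective f) {H' N' : Subgroup G'} :
    SectionStep (H'.comap f) (N'.comap f) ↔ SectionStep H' N' := by
  refine or_congr (and_congr (normalIn_comap_iff hf) ?_) (and_congr (normalIn_comap_iff hf)
    (and_congr (Subgroup.comap_injective hf).ne_iff ?_))
  · have key : ∀ x, N'.comap f ⊔ Subgroup.zpowers x = (N' ⊔ Subgroup.zpowers (f x)).comap f := by
      intro x
      have h1 : f.ker ≤ N'.comap f := fun y hy => by
        simp [MonoidHom.mem_ker.1 hy]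
      have h2 : N' ⊔ Subgroup.zpowers (f x) = (N'.comap f ⊔ Subgroup.zpowers x).map f := by
        rw [Subgroup.map_sup, Subgroup.map_comap_eq_self_of_surjective hf, MonoidHom.map_zpowers]
      rw [h2, Subgroup.comap_map_eq_self (h1.trans le_sup_left)]
    constructor
    · rintro ⟨x, hx, h⟩
      rw [key, Subgroup.comap_le_comap_of_surjective hf] at h
      exact ⟨f x, hx, h⟩
    · rintro ⟨x, hx, h⟩
      obtain ⟨x, rfl⟩ := hf x
      refine ⟨x, hx, ?_⟩
      rwa [key, Subgroup.comap_le_comap_of_surjective hf]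
  · constructor
    · intro h K hK hNK
      rcases h (K.comap f) ((normalIn_comap_iff hf).2 hK) (Subgroup.comap_mono hNK) with h | h
      · exact .inl (Subgroup.comap_injective hf h)
      · exact .inr (Subgroup.comap_injective hf h)
    · intro h K hK hNK
      have h1 : f.ker ≤ K := fun y hy => hNK (by simp [MonoidHom.mem_ker.1 hy])
      have h2 : (K.map f).comap f = K := Subgroup.comap_map_eq_self h1
      rw [← h2, normalIn_comap_iff hf] at hK
      rw [← h2, Subgroup.comap_le_comap_of_surjective hf] at hNK
      rcases h _ hK hNK with h | h
      · exact .inl (by rw [← h, h2])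
      · exact .inr (by rw [← h, h2])

theorem mem_seriesLevel_iff (A : Subgroup G) (k : ℕ) : A ∈ seriesLevel G k ↔
    ∃ M : ℕ → Subgroup G, M 0 = ⊤ ∧ M k = A ∧ ∀ i < k, SectionStep (M i) (M (i + 1)) := by
  induction k generalizing A with
  | zero =>
    constructor
    · rintro rfl
      exact ⟨fun _ => ⊤, rfl, rfl, by simp⟩
    · rintro ⟨M, h1, h2, -⟩
      exact h2.symm.trans h1
  | succ k ih =>
    constructor
    · rintro ⟨H, hH, hA⟩
      obtain ⟨M, h1, h2, h3⟩ := (ih H).1 hH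
      refine ⟨fun i => if i ≤ k then M i else A, by simpa using h1, by simp, fun i hi => ?_⟩
      by_cases hik : i = k
      · subst hik; simpa [h2] using hA
      · have : i + 1 ≤ k := by omega
        simpa [this, show i ≤ k by omega] using h3 i (by omega)
    · rintro ⟨M, h1, rfl, h3⟩
      exact ⟨M k, (ih _).2 ⟨M, h1, rfl, fun i hi => h3 i (by omega)⟩, h3 k (by omega)⟩

/-- Chains in the quotient are pulled back to `G`. Conversely each term of a chain ending in `A`
contains `A` and is therefore the full preimage of its image. -/
theorem hasCyclicOrSimpleSeries_quotient_iff (A : Subgroup G) [A.Normal] (k : ℕ) :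
    HasCyclicOrSimpleSeries (G ⧸ A) k ↔ A ∈ seriesLevel G k := by
  have hf := QuotientGroup.mk'_surjective A
  rw [mem_seriesLevel_iff]
  simp only [HasCyclicOrSimpleSeries, ← sectionStep_iff]
  constructor
  · rintro ⟨N, h1, h2, h3⟩
    refine ⟨fun i => (N i).comap (QuotientGroup.mk' A), by simp [h1], ?_, fun i hi =>
      (sectionStep_comap_iff hf).2 (h3 i hi)⟩
    simp only [h2, MonoidHom.comap_bot, QuotientGroup.ker_mk']
  · rintro ⟨M, h1, h2, h3⟩
    -- Containment of `A` is propagated upwards from the last term.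
    have hanti : ∀ j ≤ k, A ≤ M (k - j) := by
      intro j
      induction j with
      | zero => simp [h2]
      | succ j ih =>
        intro hj
        refine (ih (by omega)).trans ?_
        have h4 := (sectionStep_iff.1 (h3 (k - (j + 1)) (by omega))).1
        rwa [show k - (j + 1) + 1 = k - j by omega] at h4
    have hA : ∀ i ≤ k, ((M i).map (QuotientGroup.mk' A)).comap (QuotientGroup.mk' A) = M i := by
      intro i hi
      refine Subgroup.comap_map_eq_self ?_
      rw [QuotientGroup.ker_mk']
      simpa [show k - (k - i) = i by omega] using hanti (k - i) (by omega)
    refine ⟨fun i => (M i).map (QuotientGroup.mk' A), ?_, ?_, fun i hi => ?_⟩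
    · simpa [h1] using Subgroup.map_top_of_surjective _ hf
    · simp [h2]
    · rw [← sectionStep_comap_iff hf, hA i (by omega), hA (i + 1) (by omega)]
      exact h3 i hi

theorem hasCyclicOrSimpleSeries_one_iff (A : Subgroup G) [A.Normal] :
    HasCyclicOrSimpleSeries (G ⧸ A) 1 ↔ IsCyclicOrSimple (G ⧸ A) := by
  rw [hasCyclicOrSimpleSeries_quotient_iff]
  have h1 : A ∈ seriesLevel G 1 ↔ SectionStep ⊤ A := by simp [seriesLevel]
  rw [h1, sectionStep_iff]
  let f : (⊤ : Subgroup G) ⧸ A.subgroupOf ⊤ ≃* G ⧸ A :=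
    QuotientGroup.congr _ _ Subgroup.topEquiv (by
      ext x
      simp [Subgroup.mem_map, Subgroup.mem_subgroupOf])
  have h2 : (A.subgroupOf ⊤).Normal := inferInstance
  simp only [le_top, true_and, h2, exists_true_left]
  exact or_congr f.isCyclic f.isSimpleGroup_congr

end

/-! ## Frame conditions and loop rules -/

namespace Cmd

/-- The set variables that a command may change. -/
def sets : Cmd → List ℕ
  | skip | push _ _ | nil _ | emit _ => []
  | seq C D | ite _ C D => C.sets ++ D.sets
  | add _ y | del _ y => [y]
  | forE _ C | rep C => C.sets
  | forL _ x C => x :: C.sets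

/-- The list variables that a command may change. -/
def lists : Cmd → List ℕ
  | skip | add _ _ | del _ _ | emit _ => []
  | seq C D | ite _ C D => C.lists ++ D.lists
  | push l _ | nil l => [l]
  | forE _ C | rep C | forL _ _ C => C.lists

/-- Whether a command may write to the output. -/
def emits : Cmd → Bool
  | skip | push _ _ | nil _ | add _ _ | del _ _ => false
  | emit _ => true
  | seq C D | ite _ C D => C.emits || D.emits
  | forE _ C | rep C | forL _ _ C => C.emits

end Cmd

/-- The state `b` differs from `a` only in the given set and list variables, and in the output if
`o` is true. -/
structure Frame {G : Type*} (ss ls : List ℕ) (o : Bool) (a b : AState G) : Prop where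
  elem : b.elem = a.elem
  set : ∀ y, y ∉ ss → b.set y = a.set y
  list : ∀ l, l ∉ ls → b.list l = a.list l
  out : o = false → b.out = a.out

namespace Frame

variable {G : Type*} {ss ls ss' ls' : List ℕ} {o o' : Bool} {a b c : AState G}

theorem refl (a : AState G) : Frame ss ls o a a :=
  ⟨rfl, fun _ _ => rfl, fun _ _ => rfl, fun _ => rfl⟩

theorem trans (h : Frame ss ls o a b) (h' : Frame ss ls o b c) : Frame ss ls o a c :=
  ⟨h'.elem.trans h.elem, fun y hy => (h'.set y hy).trans (h.set y hy),
    fun y hy => (h'.list y hy).trans (h.list y hy), fun ho => (h'.out ho).trans (h.out ho)⟩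

theorem mono (h : Frame ss ls o a b) (hs : ss ⊆ ss') (hl : ls ⊆ ls') (ho : o = true → o' = true) :
    Frame ss' ls' o' a b :=
  ⟨h.elem, fun y hy => h.set y fun h' => hy (hs h'), fun y hy => h.list y fun h' => hy (hl h'),
    fun h' => h.out (by cases o <;> simp_all)⟩

end Frame

section

variable {G : Type*} [Group G] {n : ℕ} {e : G ≃ Fin n} {K B : ℕ}

/-- What a command may change is read off its syntax, so later claims that a variable survived a
subroutine reduce to membership in explicit lists. Element variables always survive, because `forE`
restores them. -/
theorem wp_frame {C : Cmd} {Φ : AState G → Prop} {a : AState G} (h : wp e K B C Φ a) :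
    wp e K B C (fun b => Φ b ∧ Frame C.sets C.lists C.emits a b) a := by
  induction C generalizing Φ a with
  | skip => exact ⟨h, .refl a⟩
  | seq C D ihC ihD =>
    refine wp_mono (C := C) (fun b hb => ?_) a (ihC h)
    refine wp_mono (C := D) (fun c hc => ⟨hc.1, ?_⟩) b (ihD hb.1)
    exact (hb.2.mono (by simp [Cmd.sets]) (by simp [Cmd.lists])
      (by simp +contextual [Cmd.emits])).trans
      (hc.2.mono (by simp [Cmd.sets]) (by simp [Cmd.lists]) (by simp +contextual [Cmd.emits]))
  | ite φ C D ihC ihD =>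
    refine ⟨fun hs => wp_mono (fun b hb => ⟨hb.1, hb.2.mono ?_ ?_ ?_⟩) a (ihC (h.1 hs)),
      fun hs => wp_mono (fun b hb => ⟨hb.1, hb.2.mono ?_ ?_ ?_⟩) a (ihD (h.2 hs))⟩ <;>
    simp +contextual [Cmd.sets, Cmd.lists, Cmd.emits]
  | add x y | del x y =>
    refine ⟨h, rfl, fun z hz => ?_, fun _ _ => rfl, fun _ => rfl⟩
    simp only [Cmd.sets, List.mem_singleton] at hz
    simp [hz]
  | forE x C ih =>
    simp only [wp] at h ⊢
    have aux : ∀ (L : List G) (b : AState G),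
        Frame C.sets C.lists C.emits a (b.setElem x (a.elem x)) →
        L.foldr (fun g Ψ b => wp e K B C Ψ (b.setElem x g))
          (fun b => Φ (b.setElem x (a.elem x))) b →
        L.foldr (fun g Ψ b => wp e K B C Ψ (b.setElem x g))
          (fun b => Φ (b.setElem x (a.elem x)) ∧
            Frame C.sets C.lists C.emits a (b.setElem x (a.elem x))) b := by
      intro L
      induction L with
      | nil => exact fun b hb h => ⟨h, hb⟩
      | cons g L ihL =>
        intro b hb h
        refine wp_mono (fun c hc => ihL c ?_ hc.1) _ (ih h)
        refine hb.trans ⟨?_, hc.2.set, hc.2.list, hc.2.out⟩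
        simp [hc.2.elem]
    exact aux _ a (by simpa using Frame.refl a) h
  | rep C ih =>
    simp only [wp] at h ⊢
    have aux : ∀ (j : ℕ) (b : AState G), Frame C.sets C.lists C.emits a b →
        (wp e K B C)^[j] Φ b →
        (wp e K B C)^[j] (fun b => Φ b ∧ Frame C.sets C.lists C.emits a b) b := by
      intro j
      induction j with
      | zero => exact fun b hb h => ⟨h, hb⟩
      | succ j ihj =>
        intro b hb h
        rw [Function.iterate_succ_apply'] at h ⊢
        exact wp_mono (fun c hc => ihj c (hb.trans hc.2) hc.1) _ (ih h)
    exact aux K a (.refl a) h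
  | forL l x C ih =>
    refine ⟨h.1, ?_⟩
    have aux : ∀ (L0 L : List (Set G)) (b : AState G),
        Frame (x :: C.sets) C.lists C.emits a b →
        L.foldr (fun S Ψ b => b.list l = L0 ∧ wp e K B C Ψ (b.setSet x S))
          (fun b => b.list l = L0 ∧ Φ b) b →
        L.foldr (fun S Ψ b => b.list l = L0 ∧ wp e K B C Ψ (b.setSet x S))
          (fun b => b.list l = L0 ∧ Φ b ∧ Frame (x :: C.sets) C.lists C.emits a b) b := by
      intro L0 L
      induction L with
      | nil => exact fun b hb h => ⟨h.1, h.2, hb⟩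
      | cons S L ihL =>
        intro b hb h
        refine ⟨h.1, wp_mono (fun c hc => ihL c ?_ hc.1) _ (ih h.2)⟩
        refine hb.trans ⟨hc.2.elem, fun y hy => ?_, hc.2.list, hc.2.out⟩
        simp only [List.mem_cons, not_or] at hy
        rw [hc.2.set y hy.2]
        simp [hy.1]
    exact aux _ _ a (.refl a) h.2
  | push l x =>
    refine ⟨h, rfl, fun _ _ => rfl, fun z hz => ?_, fun _ => rfl⟩
    simp only [Cmd.lists, List.mem_singleton] at hz
    simp [hz]
  | nil l =>
    refine ⟨h, rfl, fun _ _ => rfl, fun z hz => ?_, fun _ => rfl⟩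
    simp only [Cmd.lists, List.mem_singleton] at hz
    simp [hz]
  | emit x => exact ⟨h, rfl, fun _ _ => rfl, fun _ _ => rfl, by simp [Cmd.emits]⟩

/-- The invariant refers to the elements already treated and to states in which `x` has its old
value back, so that it can be compared with the state before the loop. -/
theorem wp_forE {C : Cmd} {Φ : AState G → Prop} {a : AState G} {x : ℕ}
    (I : List G → AState G → Prop) (h0 : I [] a)
    (hstep : ∀ L g b, Frame C.sets C.lists C.emits a b → I L b →
      wp e K B C (fun c => I (L ++ [g]) (c.setElem x (a.elem x))) (b.setElem x g))
    (hend : ∀ b, Frame C.sets C.lists C.emits a b → I (elemList e) b → Φ b) :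
    wp e K B (.forE x C) Φ a := by
  suffices h : wp e K B (.forE x C) (I (elemList e)) a from
    wp_mono (fun b hb => hend b hb.2 hb.1) a (wp_frame h)
  simp only [wp]
  have aux : ∀ (L' L : List G) (b : AState G),
      Frame C.sets C.lists C.emits a (b.setElem x (a.elem x)) →
      I L (b.setElem x (a.elem x)) → L'.foldr (fun g Ψ b => wp e K B C Ψ (b.setElem x g))
        (fun b => I (L ++ L') (b.setElem x (a.elem x))) b := by
    intro L'
    induction L' with
    | nil => intro L b _ h; simpa using h
    | cons g L' ih =>
      intro L b hb h
      have h1 := wp_frame (hstep L g _ hb h)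
      simp only [AState.setElem_setElem] at h1
      refine wp_mono (fun c hc => ?_) _ h1
      have h2 := ih (L ++ [g]) c
        (hb.trans ⟨by simp [hc.2.elem], hc.2.set, hc.2.list, hc.2.out⟩) hc.1
      simpa using h2
  exact aux (elemList e) [] a (by simpa using Frame.refl a) (by simpa using h0)

theorem wp_rep {C : Cmd} {Φ : AState G → Prop} {a : AState G} (I : ℕ → AState G → Prop)
    (h0 : I 0 a)
    (hstep : ∀ i < K, ∀ b, Frame C.sets C.lists C.emits a b → I i b → wp e K B C (I (i + 1)) b)
    (hend : ∀ b, Frame C.sets C.lists C.emits a b → I K b → Φ b) :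
    wp e K B (.rep C) Φ a := by
  suffices h : wp e K B (.rep C) (I K) a from
    wp_mono (fun b hb => hend b hb.2 hb.1) a (wp_frame h)
  simp only [wp]
  have aux : ∀ (j : ℕ), j ≤ K → ∀ (b : AState G), Frame C.sets C.lists C.emits a b →
      I (K - j) b → (wp e K B C)^[j] (I K) b := by
    intro j
    induction j with
    | zero => intro _ b _ h; simpa using h
    | succ j ih =>
      intro hj b hb h
      rw [Function.iterate_succ_apply']
      refine wp_mono (fun c hc => ih (by omega) c (hb.trans hc.2) ?_) _
        (wp_frame (hstep _ (by omega) b hb h))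
      rw [show K - j = K - (j + 1) + 1 by omega]
      exact hc.1
  exact aux K le_rfl a (.refl a) (by simpa using h0)

theorem wp_forL {C : Cmd} {Φ : AState G → Prop} {a : AState G} {l x : ℕ}
    (I : List (Set G) → AState G → Prop) (hlen : (a.list l).length ≤ B) (hl : l ∉ C.lists)
    (h0 : I [] a)
    (hstep : ∀ L S L' b, a.list l = L ++ S :: L' →
      Frame (x :: C.sets) C.lists C.emits a b → I L b →
      wp e K B C (I (L ++ [S])) (b.setSet x S))
    (hend : ∀ b, Frame (x :: C.sets) C.lists C.emits a b → I (a.list l) b → Φ b) :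
    wp e K B (.forL l x C) Φ a := by
  suffices h : wp e K B (.forL l x C) (I (a.list l)) a from
    wp_mono (fun b hb => hend b hb.2 hb.1) a (wp_frame h)
  refine ⟨hlen, ?_⟩
  have aux : ∀ (L' L : List (Set G)) (b : AState G), a.list l = L ++ L' →
      Frame (x :: C.sets) C.lists C.emits a b → I L b →
      L'.foldr (fun S Ψ b => b.list l = a.list l ∧ wp e K B C Ψ (b.setSet x S))
        (fun b => b.list l = a.list l ∧ I (a.list l) b) b := by
    intro L'
    induction L' with
    | nil => intro L b hL hb h; exact ⟨hb.list l hl, by simpa [hL] using h⟩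
    | cons S L' ih =>
      intro L b hL hb h
      refine ⟨hb.list l hl, wp_mono (fun c hc => ?_) _ (wp_frame (hstep L S L' b hL hb h))⟩
      refine ih (L ++ [S]) c (by simpa using hL) (hb.trans ⟨hc.2.elem, fun y hy => ?_,
        hc.2.list, hc.2.out⟩) hc.1
      simp only [List.mem_cons, not_or] at hy
      rw [hc.2.set y hy.2]
      simp [hy.1]
  exact aux _ [] a rfl (.refl a) h0

end

/-! ## Subroutines -/

namespace Fml

/-- Equality of elements; the variable `9` is used for the neutral element. -/
def eq (x y : ℕ) : Fml := ex 9 (and (mul 9 9 9) (mul x 9 y))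

/-- Equality of sets. -/
def eqSet (a b : ℕ) : Fml :=
  all 0 (and (imp (mem 0 a) (mem 0 b)) (imp (mem 0 b) (mem 0 a)))

variable {G : Type*} [Group G] {v : ℕ → G} {A : ℕ → Set G}

theorem sat_eq {x y : ℕ} (hx : x ≠ 9) (hy : y ≠ 9) : (eq x y).Sat v A ↔ v x = v y := by
  simp [eq, hx, hy]

@[simp] theorem sat_eqSet {a b : ℕ} : (eqSet a b).Sat v A ↔ A a = A b := by
  simp only [eqSet, sat_all, sat_and, sat_imp, sat_mem, Function.update_self, Set.ext_iff]
  exact forall_congr' fun g => ⟨fun h => ⟨h.1, h.2⟩, fun h => ⟨h.1, h.2⟩⟩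

end Fml

namespace Cmd

/-- Put the set defined by `φ`, a formula about the variable `0`, into the set variable `b`. -/
def define (b : ℕ) (φ : Fml) : Cmd := forE 0 (ite φ (add 0 b) (del 0 b))

/-- The condition that the element `1` is obtained from members of `a` by a product, or by a
conjugation with a member of `h`, or is the neutral element. -/
def generated (h a : ℕ) : Fml :=
  .or (.mul 1 1 1) <|
  .or (.ex 2 (.ex 3 (.and (.mem 2 a) (.and (.mem 3 a) (.mul 2 3 1))))) <|
  .ex 2 (.ex 3 (.ex 4 (.and (.mem 2 h) (.and (.mem 3 a) (.and (.mul 2 3 4) (.mul 1 2 4))))))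

/-- Replace `a` by the smallest subgroup containing it and normalized by `h`. -/
def close (h a : ℕ) : Cmd := forE 0 (forE 1 (ite (generated h a) (add 1 a) skip))

/-- Put the elements `x` of `q` for which `m` and `x` generate `q` as a subgroup normalized by the
set `0` into the set variable `5`. -/
def generators (q m : ℕ) : Cmd :=
  forE 10 <|
    seq (define 4 (.or (.mem 0 m) (.eq 0 10))) <|
    seq (close 0 4) <|
    ite (.and (.mem 10 q) (.eqSet 4 q)) (add 10 5) (del 10 5)

/-- Append the set `a` to the list `l` unless it is there already. -/
def insert (l a : ℕ) : Cmd :=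
  seq (del 0 6) <|
  seq (forL l 7 (ite (.eqSet a 7) (add 0 6) skip)) <|
  ite (.mem 0 6) skip (push l a)

end Cmd

/-! ### Correctness of the subroutines -/

section

variable {G : Type*} [Group G] {n : ℕ} {e : G ≃ Fin n} {K B : ℕ} {Φ : AState G → Prop}
  {a : AState G}

/-- The set `b` is overwritten while `φ` is still being evaluated; hence the truth of `φ` is
required to be independent of the value `T` of `b`. -/
theorem wp_define {b : ℕ} {φ : Fml} (P : G → Prop)
    (hφ : ∀ g T, φ.Sat (Function.update a.elem 0 g) (Function.update a.set b T) ↔ P g)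
    (h : ∀ c, Frame [b] [] false a c → c.set b = {g | P g} → Φ c) :
    wp e K B (.define b φ) Φ a := by
  refine wp_forE (fun L c => ∀ g ∈ L, g ∈ c.set b ↔ P g) (by simp) ?_ ?_
  · intro L g c hc hI
    have hset : c.set = Function.update a.set b (c.set b) := by
      ext1 y
      by_cases hy : y = b
      · subst hy; simp
      · rw [hc.set y (by simp [Cmd.sets, hy])]; simp [hy]
    have hs : φ.Sat (c.setElem 0 g).elem (c.setElem 0 g).set ↔ P g := by
      rw [AState.setElem_elem, AState.setElem_set, hset, hc.elem, hφ]
    refine ⟨fun h1 => ?_, fun h1 => ?_⟩ <;>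
    · rw [hs] at h1
      intro k hk
      rw [List.mem_append, List.mem_singleton] at hk
      by_cases hkg : k = g
      · subst hkg; simp [h1]
      · simp [hkg, hI k (hk.resolve_right hkg)]
  · intro c hc hI
    refine h c (hc.mono (by simp [Cmd.sets]) (by simp [Cmd.lists]) (by simp [Cmd.emits])) ?_
    ext g
    exact hI g (mem_elemList g)

theorem sat_generated {v : ℕ → G} {A : ℕ → Set G} {h b : ℕ} :
    (Cmd.generated h b).Sat v A ↔ v 1 = 1 ∨ (∃ x ∈ A b, ∃ y ∈ A b, x * y = v 1) ∨
      ∃ k ∈ A h, ∃ x ∈ A b, k * x * k⁻¹ = v 1 := by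
  simp only [Cmd.generated, Fml.sat_or, Fml.sat_mul, Fml.sat_ex, Fml.sat_and, Fml.sat_mem]
  refine or_congr (by simp) (or_congr ?_ ?_)
  · simp
  · simp [mul_inv_eq_iff_eq_mul, eq_comm]

theorem wp_close {h b : ℕ} (hb : h ≠ b) {H : Subgroup G} (hH : a.set h = H)
    (hΦ : ∀ c, Frame [b] [] false a c → c.set b = ncl H (a.set b) → Φ c) :
    wp e K B (.close h b) Φ a := by
  have hfin : Finite G := Finite.of_equiv _ e.symm
  have hGn : Nat.card G = n := by simpa using Nat.card_congr e
  -- The outer loop serves only as a counter. A pass that changes nothing proves closedness and any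
  -- other pass adds an element, so as many passes as the group has elements suffice.
  refine wp_forE (fun L c => a.set b ⊆ c.set b ∧ c.set b ⊆ ncl H (a.set b) ∧
    (c.set b = ncl H (a.set b) ∨ L.length ≤ (c.set b).ncard))
    ⟨subset_rfl, subset_ncl, by simp⟩ ?_ ?_
  · intro L g0 c hc hI
    refine wp_forE (fun L' d => c.set b ⊆ d.set b ∧ d.set b ⊆ ncl H (a.set b) ∧
      ∀ g ∈ L', (g = 1 ∨ (∃ x ∈ c.set b, ∃ y ∈ c.set b, x * y = g) ∨
        ∃ k ∈ H, ∃ x ∈ c.set b, k * x * k⁻¹ = g) → g ∈ d.set b)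
      ⟨subset_rfl, hI.2.1, by simp⟩ ?_ ?_
    · intro L' g d hd hI'
      have hdh : d.set h = H := by
        rw [hd.set h (by simp [Cmd.sets, hb]), AState.setElem_set,
          hc.set h (by simp [Cmd.sets, hb]), hH]
      refine ⟨fun hs => ?_, fun hs => ?_⟩
      · rw [sat_generated] at hs
        simp only [AState.setElem_elem, Function.update_self, AState.setElem_set, hdh] at hs
        refine ⟨?_, ?_, ?_⟩
        · simpa using hI'.1.trans (Set.subset_insert _ _)
        · simp only [AState.setElem_elem, Function.update_self, AState.setElem_set,
            AState.setSet_set]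
          refine Set.insert_subset ?_ hI'.2.1
          rcases hs with rfl | ⟨x, hx, y, hy, rfl⟩ | ⟨k, hk, x, hx, rfl⟩
          · exact one_mem _
          · exact mul_mem (hI'.2.1 hx) (hI'.2.1 hy)
          · exact conj_mem_ncl hk (hI'.2.1 hx)
        · intro k hk hk'
          simp only [AState.setElem_elem, Function.update_self, AState.setElem_set,
            AState.setSet_set]
          rw [List.mem_append, List.mem_singleton] at hk
          rcases hk with hk | rfl
          · exact .inr (hI'.2.2 k hk hk')
          · exact .inl rfl
      · rw [sat_generated] at hs
        simp only [AState.setElem_elem, Function.update_self, AState.setElem_set, hdh] at hs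
        refine ⟨hI'.1, hI'.2.1, fun k hk hk' => ?_⟩
        rw [List.mem_append, List.mem_singleton] at hk
        rcases hk with hk | rfl
        · exact hI'.2.2 k hk hk'
        · refine absurd ?_ hs
          rcases hk' with h1 | ⟨x, hx, y, hy, h1⟩ | ⟨k, hk, x, hx, h1⟩
          · exact .inl h1
          · exact .inr (.inl ⟨x, hI'.1 hx, y, hI'.1 hy, h1⟩)
          · exact .inr (.inr ⟨k, hk, x, hI'.1 hx, h1⟩)
    · intro d hd hI'
      refine ⟨hI.1.trans hI'.1, hI'.2.1, ?_⟩
      simp only [AState.setElem_set, List.length_append, List.length_singleton]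
      rcases hI.2.2 with h1 | h1
      · exact .inl (hI'.2.1.antisymm (h1 ▸ hI'.1))
      · by_cases hcl : d.set b = c.set b
        · left
          have hgen := fun g hg => hcl ▸ hI'.2.2 g (mem_elemList g) hg
          rw [hcl]
          exact ncl_eq_of_closed hI.1 hI.2.1 (hgen 1 (.inl rfl))
            (fun x hx y hy => hgen _ (.inr (.inl ⟨x, hx, y, hy, rfl⟩)))
            (fun k hk x hx => hgen _ (.inr (.inr ⟨k, hk, x, hx, rfl⟩)))
        · right
          have := Set.ncard_lt_ncard (hI'.1.ssubset_of_ne (Ne.symm hcl)) (Set.toFinite _)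
          omega
  · intro c hc hI
    refine hΦ c (hc.mono (by simp [Cmd.sets]) (by simp [Cmd.lists]) (by simp [Cmd.emits])) ?_
    rcases hI.2.2 with h1 | h1
    · exact h1
    · refine Set.eq_of_subset_of_ncard_le hI.2.1 ?_ (Set.toFinite _)
      refine (Set.ncard_le_ncard (Set.subset_univ _) (Set.toFinite _)).trans ?_
      rw [Set.ncard_univ, hGn]
      simpa [elemList] using h1

theorem wp_generators {q m : ℕ} (hq : q ≠ 4 ∧ q ≠ 5) (hm : m ≠ 4 ∧ m ≠ 5) {H : Subgroup G}
    (hH : a.set 0 = H)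
    (hΦ : ∀ c, Frame [4, 5] [] false a c →
      c.set 5 = {x | x ∈ a.set q ∧ (ncl H (Insert.insert x (a.set m)) : Set G) = a.set q} → Φ c) :
    wp e K B (.generators q m) Φ a := by
  refine wp_forE (fun L c => ∀ x ∈ L, x ∈ c.set 5 ↔
    x ∈ a.set q ∧ (ncl H (Insert.insert x (a.set m)) : Set G) = a.set q) (by simp) ?_ ?_
  · intro L x c hc hI
    have hcq : c.set q = a.set q := hc.set q (by simp [Cmd.sets, Cmd.define, Cmd.close, hq])
    have hcm : c.set m = a.set m := hc.set m (by simp [Cmd.sets, Cmd.define, Cmd.close, hm])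
    have hc0 : c.set 0 = H := (hc.set 0 (by simp [Cmd.sets, Cmd.define, Cmd.close])).trans hH
    refine wp_define (fun g => g ∈ Insert.insert x (a.set m)) (fun g T => ?_) fun c1 h1 h1' => ?_
    · simp [Fml.sat_eq, hm, hcm, or_comm]
    refine wp_close (H := H) (by omega) ?_ fun c2 h2 h2' => ?_
    · rw [h1.set 0 (by simp)]; exact hc0
    have h3 := (h1.mono (ss' := [4]) (o' := false) (by simp) (by simp) (by simp)).trans h2
    have h5 : c2.set 5 = c.set 5 := h3.set 5 (by simp)
    have hx : c2.elem 10 = x := by rw [h3.elem]; simp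
    have hs : (Fml.and (.mem 10 q) (.eqSet 4 q)).Sat c2.elem c2.set ↔
        x ∈ a.set q ∧ (ncl H (Insert.insert x (a.set m)) : Set G) = a.set q := by
      have h6 : c2.set q = a.set q := (h3.set q (by simp [hq])).trans hcq
      simp only [Fml.sat_and, Fml.sat_mem, Fml.sat_eqSet, hx, h6, h2', h1']
      rfl
    refine ⟨fun h7 => ?_, fun h7 => ?_⟩ <;>
    · rw [hs] at h7
      intro k hk
      rw [List.mem_append, List.mem_singleton] at hk
      by_cases hkx : k = x
      · subst hkx; simp [hx, h7]
      · simp [hx, h5, hkx, hI k (hk.resolve_right hkx)]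
  · intro c hc hI
    refine hΦ c (hc.mono ?_ ?_ ?_) (Set.ext fun g => hI g (mem_elemList g)) <;>
      simp [Cmd.sets, Cmd.lists, Cmd.emits, Cmd.define, Cmd.close]

theorem wp_insert {l b : ℕ} (hb : b ≠ 6 ∧ b ≠ 7) (hlen : (a.list l).length ≤ B)
    (hmem : ∀ c, Frame [6, 7] [l] false a c → a.set b ∈ a.list l → c.list l = a.list l → Φ c)
    (hnew : ∀ c, Frame [6, 7] [l] false a c → a.set b ∉ a.list l →
      c.list l = a.list l ++ [a.set b] → Φ c) :
    wp e K B (.insert l b) Φ a := by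
  -- The set `6` is used as a flag: whether it contains the current value of the element variable
  -- `0`, whatever that is.
  refine wp_forL (fun L c => a.elem 0 ∈ c.set 6 ↔ a.set b ∈ L) hlen (by simp [Cmd.lists])
    (by simp) ?_ ?_
  · intro L S L' c _ hc hI
    have hcb : c.set b = a.set b := by
      rw [hc.set b (by simp [Cmd.sets, hb])]; simp [hb]
    have hel : c.elem 0 = a.elem 0 := by rw [hc.elem]; rfl
    refine ⟨fun h1 => ?_, fun h1 => ?_⟩
    · have h2 : a.set b = S := by simpa [hb, hcb] using h1
      simp [wp, hel, h2]
    · have h2 : a.set b ≠ S := by simpa [hb, hcb] using h1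
      change a.elem 0 ∈ (c.setSet 7 S).set 6 ↔ _
      simp [hI, h2]
  · intro c hc hI
    have hel : c.elem 0 = a.elem 0 := by rw [hc.elem]; rfl
    have hcb : c.set b = a.set b := by
      rw [hc.set b (by simp [Cmd.sets, hb])]; simp [hb]
    have hcl : c.list l = a.list l := by
      rw [hc.list l (by simp [Cmd.lists])]; rfl
    have hfr : Frame [6, 7] [l] false a c := by
      refine ⟨by rw [hc.elem]; rfl, fun y hy => ?_, fun y hy => ?_, fun _ => ?_⟩
      · simp at hy
        rw [hc.set y (by simp [Cmd.sets, hy])]; simp [hy]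
      · rw [hc.list y (by simp [Cmd.lists])]; rfl
      · rw [hc.out (by simp [Cmd.emits])]; rfl
    refine ⟨fun h1 => hmem c hfr ?_ hcl, fun h1 => hnew _ ?_ ?_ ?_⟩
    · rw [Fml.sat_mem, hel, hI] at h1
      exact h1
    · refine hfr.trans ⟨rfl, fun _ _ => rfl, fun y hy => ?_, fun _ => rfl⟩
      simp at hy
      simp [hy]
    · rw [Fml.sat_mem, hel, hI] at h1
      exact h1
    · simp [hcl, hcb]

end

/-! ## The enumeration of sections -/

namespace Cmd

/-- With subgroups `0` = `H`, `1` = `Q`, `2` = `N` and the element `12` = `y`: insert the subgroup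
generated by `N` and `y` into the list `3` if its quotient in `Q` is cyclic. -/
def candidate : Cmd :=
  ite (.mem 12 1)
    (seq (define 3 (.or (.mem 0 2) (.eq 0 12))) <|
      seq (close 0 3) <|
      seq (generators 1 3) <|
      ite (.ex 0 (.mem 0 5)) (insert 3 3) skip)
    skip

/-- Enlarge the subgroup `1` by the element `11`, and replace the list `2` of subgroups with cyclic
quotient accordingly. -/
def stage : Cmd :=
  seq (add 11 1) <|
  seq (close 0 1) <|
  seq (nil 3) <|
  seq (forL 2 2 (forE 12 candidate)) <|
  seq (nil 2) <|
  forL 3 2 (insert 2 2)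

/-- The element `0` is a commutator of members of the set `0`. -/
def isCommutator : Fml :=
  .ex 2 (.and (.mem 2 0) (.ex 3 (.and (.mem 3 0)
    (.ex 4 (.and (.mul 2 3 4) (.ex 5 (.and (.mul 3 2 5) (.mul 0 5 4))))))))

/-- Put the normal subgroups of the subgroup `0` with cyclic quotient into the list `2`. -/
def cyclicSections : Cmd :=
  seq (define 1 isCommutator) <|
  seq (close 0 1) <|
  seq (nil 2) <|
  seq (push 2 1) <|
  forE 11 (ite (.mem 11 0) stage skip)

/-- Put the members of the subgroup `0` whose normal closure does not contain the element `13`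
into the set variable `3`. -/
def avoid : Cmd :=
  forE 14 <|
    seq (define 4 (.eq 0 14)) <|
    seq (close 0 4) <|
    ite (.and (.mem 14 0) (.neg (.mem 13 4))) (add 14 3) (del 14 3)

/-- Insert the set `3` into the list `1` if it is a normal subgroup of the subgroup `0` and
generates the subgroup together with any element outside. -/
def insertIfMaximal : Cmd :=
  seq (define 4 (.mem 0 3)) <|
  seq (close 0 4) <|
  ite (.eqSet 4 3)
    (seq (generators 0 3) <|
      ite (.all 0 (.imp (.mem 0 0) (.or (.mem 0 3) (.mem 0 5)))) (insert 1 3) skip)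
    skip

/-- Insert the normal subgroups of the subgroup `0` with non-abelian simple quotient into the
list `1`. -/
def simpleSections : Cmd :=
  forE 13 (ite (.mem 13 0) (seq avoid insertIfMaximal) skip)

/-- Insert the normal subgroups of the subgroup `0` with cyclic or simple quotient into the
list `1`. -/
def sections : Cmd :=
  seq cyclicSections (seq (forL 2 2 (insert 1 2)) simpleSections)

/-- Replace the list `0` of subgroups by the list of their normal subgroups with cyclic or simple
quotient. -/
def descend : Cmd :=
  seq (nil 1) (seq (forL 0 0 sections) (seq (nil 0) (forL 1 0 (insert 0 0))))

/-- The set `0` is invariant under conjugation. -/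
def isInvariant : Fml :=
  .all 0 (.all 1 (.all 2 (.all 3
    (.imp (.and (.mem 1 0) (.and (.mul 0 1 2) (.mul 3 0 2))) (.mem 3 0)))))

/-- Output the normal subgroups with a series of the prescribed length. -/
def enumerate : Cmd :=
  seq (define 0 (.ex 1 (.mul 1 1 1))) <|
  seq (push 0 0) <|
  seq (rep descend) <|
  forL 0 0 (ite isInvariant (emit 0) skip)

end Cmd

/-! ### Correctness of the enumeration -/

section

open scoped commutatorElement

variable {G : Type*} [Group G] {n : ℕ} {e : G ≃ Fin n} {K B : ℕ} {Φ : AState G → Prop}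
  {a : AState G}

theorem wp_seq {C D : Cmd} : wp e K B (.seq C D) Φ a = wp e K B C (wp e K B D Φ) a := rfl

theorem wp_nil {l : ℕ} : wp e K B (.nil l) Φ a = Φ (a.setList l []) := rfl

theorem wp_push {l x : ℕ} :
    wp e K B (.push l x) Φ a = Φ (a.setList l (a.list l ++ [a.set x])) := rfl

theorem wp_of_wp {C : Cmd} {Ψ : AState G → Prop} (h : wp e K B C Ψ a)
    (hΦ : ∀ c, Frame C.sets C.lists C.emits a c → Ψ c → Φ c) : wp e K B C Φ a :=
  wp_mono (fun c hc => hΦ c hc.2 hc.1) a (wp_frame h)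

/-- The list consists of distinct carriers of subgroups in `𝒮`. -/
def ListsIn (𝒮 : Set (Subgroup G)) (L : List (Set G)) : Prop :=
  L.Nodup ∧ ∀ S ∈ L, ∃ N ∈ 𝒮, (N : Set G) = S

theorem ListsIn.length_le [Finite G] {𝒮 : Set (Subgroup G)} {L : List (Set G)}
    (h : ListsIn 𝒮 L) (h𝒮 : 𝒮.ncard ≤ B) : L.length ≤ B :=
  (List.length_le_of_subset_carriers h.1 h.2).trans h𝒮

theorem listsIn_nil (𝒮 : Set (Subgroup G)) : ListsIn 𝒮 [] := ⟨List.nodup_nil, by simp⟩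

theorem wp_insert_listsIn {𝒮 : Set (Subgroup G)} {l b : ℕ} (h𝒮 : 𝒮.ncard ≤ B)
    (hb : b ≠ 6 ∧ b ≠ 7) (hl : ListsIn 𝒮 (a.list l)) (hS : ∃ N ∈ 𝒮, (N : Set G) = a.set b) :
    wp e K B (.insert l b) (fun c => ListsIn 𝒮 (c.list l) ∧
      ∀ S, S ∈ c.list l ↔ S ∈ a.list l ∨ S = a.set b) a := by
  have hfin : Finite G := Finite.of_equiv _ e.symm
  refine wp_insert hb (hl.length_le h𝒮) (fun c _ h1 h2 => ?_) fun c _ h1 h2 => ?_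
  · rw [h2]
    refine ⟨hl, fun S => ⟨.inl, ?_⟩⟩
    rintro (h | rfl)
    · exact h
    · exact h1
  · rw [h2]
    refine ⟨⟨?_, fun S hS' => ?_⟩, by simp⟩
    · rw [List.nodup_append]
      refine ⟨hl.1, List.nodup_singleton _, ?_⟩
      rintro S hS' T hT rfl
      rw [List.mem_singleton] at hT
      exact h1 (hT ▸ hS')
    · rw [List.mem_append, List.mem_singleton] at hS'
      rcases hS' with h | rfl
      · exact hl.2 S h
      · exact hS

theorem wp_insertAll {𝒮 : Set (Subgroup G)} {src dst x : ℕ} (h𝒮 : 𝒮.ncard ≤ B)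
    (hx : x ≠ 6 ∧ x ≠ 7) (hne : src ≠ dst) (hsrc : ListsIn 𝒮 (a.list src))
    (hdst : ListsIn 𝒮 (a.list dst)) :
    wp e K B (.forL src x (.insert dst x)) (fun c => ListsIn 𝒮 (c.list dst) ∧
      ∀ S, S ∈ c.list dst ↔ S ∈ a.list dst ∨ S ∈ a.list src) a := by
  have hfin : Finite G := Finite.of_equiv _ e.symm
  refine wp_forL (fun L c => ListsIn 𝒮 (c.list dst) ∧
      ∀ S, S ∈ c.list dst ↔ S ∈ a.list dst ∨ S ∈ L) (hsrc.length_le h𝒮)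
      (by simp [Cmd.lists, Cmd.insert, hne]) ⟨hdst, by simp⟩ ?_ fun _ _ h => h
  intro L S L' c hL hc hI
  refine wp_of_wp (wp_insert_listsIn h𝒮 hx (by simpa using hI.1) ?_)
    fun d hd h => ⟨h.1, fun T => ?_⟩
  · simpa using hsrc.2 S (by simp [hL])
  · rw [h.2 T]
    simp [hI.2 T, or_assoc]

/-- The subgroups containing the commutator subgroup of `H` that are normal in `Q` with cyclic
quotient. -/
def cyclicFamily (H Q : Subgroup G) : Set (Subgroup G) := {M | ⁅H, H⁆ ≤ M ∧ CyclicIn M Q}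

theorem ncard_cyclicFamily_le [Finite G] (H Q : Subgroup G) :
    (cyclicFamily H Q).ncard ≤ Nat.card G :=
  (Set.ncard_le_ncard (fun _ h => h.2) (Set.toFinite _)).trans (ncard_cyclicIn_le Q)

/-- Above the commutator subgroup closures are joins. So `close` produces the join `M` of `N` with
the powers of `y`, and `generators` finds the elements that generate `Q` together with `M`; one
exists exactly when `Q/M` is cyclic. -/
theorem wp_candidate {H Q N : Subgroup G} (hB : n ≤ B) (h0 : a.set 0 = H) (h1 : a.set 1 = Q)
    (h2 : a.set 2 = N) (hQ : Q ≤ H) (hN : ⁅H, H⁆ ≤ N) (hNQ : N ≤ Q)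
    (hl : ListsIn (cyclicFamily H Q) (a.list 3)) :
    wp e K B .candidate (fun c => ListsIn (cyclicFamily H Q) (c.list 3) ∧
      (∀ S ∈ a.list 3, S ∈ c.list 3) ∧
      (a.elem 12 ∈ Q → CyclicIn (N ⊔ Subgroup.zpowers (a.elem 12)) Q →
        ((N ⊔ Subgroup.zpowers (a.elem 12) : Subgroup G) : Set G) ∈ c.list 3)) a := by
  have hfin : Finite G := Finite.of_equiv _ e.symm
  have hGn : Nat.card G = n := by simpa using Nat.card_congr e
  set y := a.elem 12 with hy
  refine ⟨fun hs => ?_, fun hs => ?_⟩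
  swap
  · rw [Fml.sat_mem, h1] at hs
    exact ⟨hl, fun _ h => h, fun h => absurd h hs⟩
  rw [Fml.sat_mem, h1, ← hy] at hs
  have hyQ : y ∈ Q := hs
  have hMQ : N ⊔ Subgroup.zpowers y ≤ Q := sup_le hNQ (by simpa using hyQ)
  set M := N ⊔ Subgroup.zpowers y with hM
  have hDM : ⁅H, H⁆ ≤ M := hN.trans le_sup_left
  refine wp_define (fun g => g ∈ insert y (N : Set G)) (fun g T => ?_) fun c1 hc1 hc1' => ?_
  · simp [Fml.sat_eq, h2, hy, or_comm]
  refine wp_close (H := H) (by omega) ?_ fun c2 hc2 hc2' => ?_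
  · rw [hc1.set 0 (by decide), h0]
  have hc := hc1.trans hc2
  have hset3 : c2.set 3 = M := by
    rw [hc2', hc1', hM, ← ncl_insert_eq_sup hN (hNQ.trans hQ) (hQ hyQ)]
    rfl
  refine wp_generators (H := H) (by omega) (by omega) ?_ fun c3 hc3 hc3' => ?_
  · rw [hc.set 0 (by decide), h0]
  have hV : c3.set 5 = {x | x ∈ Q ∧ M ⊔ Subgroup.zpowers x = Q} := by
    rw [hc3', hset3, hc.set 1 (by decide), h1]
    ext x
    refine and_congr_right fun hx => ?_
    rw [SetLike.coe_set_eq, ncl_insert_eq_sup hDM (hMQ.trans hQ) (hQ hx)]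
  have hcyc : (Fml.ex 0 (.mem 0 5)).Sat c3.elem c3.set ↔ CyclicIn M Q := by
    have hn : NormalIn M Q :=
      ⟨hMQ, fun h hh => (normalIn_of_commutator_le hDM (hMQ.trans hQ)).2 h (hQ hh)⟩
    simp only [Fml.sat_ex, Fml.sat_mem, Function.update_self, hV]
    constructor
    · rintro ⟨x, hx, hxQ⟩
      exact ⟨hn, x, hx, hxQ.ge⟩
    · rintro ⟨-, x, hx, hxQ⟩
      exact ⟨x, hx, le_antisymm (sup_le hMQ (by simpa using hx)) hxQ⟩
  have hl3 : c3.list 3 = a.list 3 := by rw [hc3.list 3 (by decide), hc.list 3 (by decide)]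
  have hs3 : c3.set 3 = M := by rw [hc3.set 3 (by decide), hset3]
  refine ⟨fun h => ?_, fun h => ?_⟩
  · rw [hcyc] at h
    refine wp_of_wp (wp_insert_listsIn ((ncard_cyclicFamily_le H Q).trans (hGn.le.trans hB))
      (by omega) (by rwa [hl3]) ⟨M, ⟨hDM, h⟩, hs3.symm⟩) fun d hd hd' => ⟨hd'.1, fun S hS => ?_,
        fun _ _ => ?_⟩
    · rw [hd'.2, hl3]
      exact .inl hS
    · rw [hd'.2, hs3]
      exact .inr rfl
  · rw [hcyc] at h
    change ListsIn _ (c3.list 3) ∧ _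
    rw [hl3]
    exact ⟨hl, fun _ h => h, fun _ h' => absurd h' h⟩

/-- By `exists_inf_sup_eq` each new intersection is an old one enlarged by some `y`, and it passes
the cyclicity test by `CyclicIn.inf`. The test also bounds the list for the next stage. -/
theorem wp_stage {H Q : Subgroup G} (hB : n ≤ B) (h0 : a.set 0 = H) (h1 : a.set 1 = Q)
    (hD : ⁅H, H⁆ ≤ Q) (hQ : Q ≤ H) (hg : a.elem 11 ∈ H)
    (hl : ListsIn (cyclicFamily H Q) (a.list 2))
    (hall : ∀ N, CyclicIn N H → ((N ⊓ Q : Subgroup G) : Set G) ∈ a.list 2) :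
    wp e K B .stage (fun c =>
      c.set 1 = ((Q ⊔ Subgroup.zpowers (a.elem 11) : Subgroup G) : Set G) ∧
      ListsIn (cyclicFamily H (Q ⊔ Subgroup.zpowers (a.elem 11))) (c.list 2) ∧
      ∀ N, CyclicIn N H →
        ((N ⊓ (Q ⊔ Subgroup.zpowers (a.elem 11)) : Subgroup G) : Set G) ∈ c.list 2) a := by
  have hfin : Finite G := Finite.of_equiv _ e.symm
  have hGn : Nat.card G = n := by simpa using Nat.card_congr e
  set g := a.elem 11 with hga
  set Q' := Q ⊔ Subgroup.zpowers g with hQ'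
  have hQQ' : Q ≤ Q' := le_sup_left
  have hQ'H : Q' ≤ H := sup_le hQ (by simpa using hg)
  have hcard := fun Q => (ncard_cyclicFamily_le H Q).trans (hGn.le.trans hB)
  refine wp_close (H := H) (by omega) (by simpa using h0) fun c1 hc1 hc1' => ?_
  have hs1 : c1.set 1 = Q' := by
    rw [hc1', hQ', ← ncl_insert_eq_sup hD hQ hg, ← h1]
    simp [hga]
  have hs0 : c1.set 0 = H := by rw [hc1.set 0 (by decide)]; simpa using h0
  have hl2 : c1.list 2 = a.list 2 := by rw [hc1.list 2 (by decide)]; rfl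
  refine wp_forL (fun L c => ListsIn (cyclicFamily H Q') (c.list 3) ∧ ∀ N : Subgroup G,
    (N : Set G) ∈ L → ∀ y ∈ Q', CyclicIn (N ⊔ Subgroup.zpowers y) Q' →
      ((N ⊔ Subgroup.zpowers y : Subgroup G) : Set G) ∈ c.list 3) ?_ (by decide)
      ⟨by simpa using listsIn_nil _, by simp⟩ ?_ ?_
  · simp [hl2, hl.length_le (hcard Q)]
  · intro L S L' c hL hc hI
    have hSl : S ∈ a.list 2 := by
      have : S ∈ (c1.setList 3 []).list 2 := by simp [hL]
      simpa [hl2] using this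
    obtain ⟨N, ⟨hDN, hNQ⟩, rfl⟩ := hl.2 S hSl
    refine wp_forE (fun L1 d => ListsIn (cyclicFamily H Q') (d.list 3) ∧
      (∀ S ∈ c.list 3, S ∈ d.list 3) ∧ ∀ y ∈ L1, y ∈ Q' → CyclicIn (N ⊔ Subgroup.zpowers y) Q' →
      ((N ⊔ Subgroup.zpowers y : Subgroup G) : Set G) ∈ d.list 3)
      ⟨hI.1, fun _ h => h, by simp⟩ ?_ ?_
    · intro L1 y d hd hI1
      refine wp_of_wp (wp_candidate (H := H) (Q := Q') (N := N) hB ?_ ?_ ?_ hQ'H hDN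
        (hNQ.1.1.trans hQQ') hI1.1) fun d' hd' h => ⟨h.1, fun S hS => h.2.1 S (hI1.2.1 S hS), ?_⟩
      · rw [AState.setElem_set, hd.set 0 (by decide)]
        rw [AState.setSet_set, Function.update_of_ne (by decide), hc.set 0 (by decide)]
        exact hs0
      · rw [AState.setElem_set, hd.set 1 (by decide)]
        rw [AState.setSet_set, Function.update_of_ne (by decide), hc.set 1 (by decide)]
        exact hs1
      · rw [AState.setElem_set, hd.set 2 (by decide)]
        simp
      · intro z hz hzQ hzc
        rw [List.mem_append, List.mem_singleton] at hz
        rcases hz with hz | rfl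
        · exact h.2.1 _ (hI1.2.2 z hz hzQ hzc)
        · simpa using h.2.2 (by simpa using hzQ) (by simpa using hzc)
    · intro d hd hI1
      refine ⟨hI1.1, fun N' hN' y hy hyc => ?_⟩
      rw [List.mem_append, List.mem_singleton] at hN'
      rcases hN' with hN' | hN'
      · exact hI1.2.1 _ (hI.2 N' hN' y hy hyc)
      · obtain rfl := SetLike.coe_injective hN'
        exact hI1.2.2 y (mem_elemList y) hy hyc
  · intro c hc hI
    refine wp_of_wp (wp_insertAll (𝒮 := cyclicFamily H Q') (hcard Q') (by omega) (by omega)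
      (by simpa using hI.1) (by simpa using listsIn_nil _)) fun d hd hd' => ⟨?_, hd'.1, ?_⟩
    · rw [hd.set 1 (by decide)]
      rw [hc.set 1 (by decide)]
      exact hs1
    · intro N hN
      rw [hd'.2]
      right
      obtain ⟨y, hy, hyN⟩ := exists_inf_sup_eq N hD hQ hg
      rw [hyN]
      have h3 := hI.2 (N ⊓ Q) (by simpa [hl2] using hall N hN) y hy
        (by rw [← hyN]; exact hN.inf hQ'H)
      simpa using h3

theorem sat_isCommutator {v : ℕ → G} {A : ℕ → Set G} : Cmd.isCommutator.Sat v A ↔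
    ∃ x ∈ A 0, ∃ y ∈ A 0, x * y = v 0 * (y * x) := by
  simp [Cmd.isCommutator, eq_comm]

theorem wp_cyclicSections {H : Subgroup G} (hB : n ≤ B) (h0 : a.set 0 = H) :
    wp e K B .cyclicSections (fun c => ListsIn (cyclicFamily H H) (c.list 2) ∧
      ∀ N, CyclicIn N H → (N : Set G) ∈ c.list 2) a := by
  refine wp_define (fun g => ∃ x ∈ H, ∃ y ∈ H, x * y = g * (y * x)) (fun g T => ?_)
    fun c1 hc1 hc1' => ?_
  · simp [sat_isCommutator, h0]
  refine wp_close (H := H) (by omega) (by rw [hc1.set 0 (by decide), h0]) fun c2 hc2 hc2' => ?_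
  have hs1 : c2.set 1 = (⁅H, H⁆ : Subgroup G) := by
    rw [hc2', hc1', ncl_commutators]
  have hs0 : c2.set 0 = H := by rw [(hc1.trans hc2).set 0 (by decide), h0]
  have hDH : ⁅H, H⁆ ≤ H := Subgroup.commutator_le.2 fun a ha b hb =>
    H.mul_mem (H.mul_mem (H.mul_mem ha hb) (H.inv_mem ha)) (H.inv_mem hb)
  rw [wp_seq, wp_nil, wp_seq, wp_push]
  refine wp_forE (fun L c => ∃ Q : Subgroup G, c.set 1 = Q ∧ ⁅H, H⁆ ≤ Q ∧ Q ≤ H ∧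
    (∀ g ∈ L, g ∈ H → g ∈ Q) ∧ ListsIn (cyclicFamily H Q) (c.list 2) ∧
    ∀ N, CyclicIn N H → ((N ⊓ Q : Subgroup G) : Set G) ∈ c.list 2) ?_ ?_ ?_
  -- Initially one entry is enough: every `N` with cyclic quotient contains the commutator subgroup.
  · refine ⟨⁅H, H⁆, hs1, le_rfl, hDH, by simp, ⟨by simp, ?_⟩, fun N hN => ?_⟩
    · simp only [AState.setList_list, Function.update_self, List.nil_append,
        List.mem_singleton, forall_eq, AState.setList_set]
      exact ⟨⁅H, H⁆, ⟨le_rfl, normalIn_self _, 1, one_mem _, le_sup_left⟩, hs1.symm⟩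
    · rw [inf_eq_right.2 hN.commutator_le]
      simp [hs1]
  · rintro L g c hc ⟨Q, h1, h2, h3, h4, h5, h6⟩
    have hc0 : c.set 0 = H := by rw [hc.set 0 (by decide)]; exact hs0
    refine ⟨fun hs => ?_, fun hs => ?_⟩
    · have hg : g ∈ H := by simpa [hc0] using hs
      have hst := wp_stage (e := e) (K := K) (a := c.setElem 11 g) hB hc0 h1 h2 h3
        (by simpa using hg) h5 h6
      simp only [AState.setElem_elem, Function.update_self] at hst
      refine wp_mono (fun d hd => ⟨_, hd.1, h2.trans le_sup_left, sup_le h3 (by simpa using hg),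
        fun k hk hkH => ?_, hd.2⟩) _ hst
      rw [List.mem_append, List.mem_singleton] at hk
      rcases hk with hk | rfl
      · exact (le_sup_left : Q ≤ _) (h4 k hk hkH)
      · exact (le_sup_right : _ ≤ Q ⊔ _) (Subgroup.mem_zpowers k)
    · have hg : g ∉ H := by simpa [hc0] using hs
      refine ⟨Q, h1, h2, h3, fun k hk hkH => ?_, h5, h6⟩
      rw [List.mem_append, List.mem_singleton] at hk
      rcases hk with hk | rfl
      · exact h4 k hk hkH
      · exact absurd hkH hg
  · rintro c hc ⟨Q, h1, h2, h3, h4, h5, h6⟩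
    -- All elements of `H` have been absorbed, so the intersections in the list are the subgroups
    -- `N` themselves.
    obtain rfl : Q = H := le_antisymm h3 fun g hg => h4 g (mem_elemList g) hg
    refine ⟨h5, fun N hN => ?_⟩
    have := h6 N hN
    rwa [inf_eq_left.2 hN.1.1] at this

theorem wp_avoid {H : Subgroup G} (h0 : a.set 0 = H) :
    wp e K B .avoid (fun c => c.set 3 = avoiding H (a.elem 13)) a := by
  refine wp_forE (fun L c => ∀ y ∈ L, y ∈ c.set 3 ↔ y ∈ avoiding H (a.elem 13)) (by simp) ?_
    fun c _ hI => Set.ext fun y => hI y (mem_elemList y)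
  intro L y c hc hI
  have hc0 : c.set 0 = H := by rw [hc.set 0 (by decide), h0]
  refine wp_define (fun g => g = y) (fun g T => by simp [Fml.sat_eq]) fun c1 hc1 hc1' => ?_
  refine wp_close (H := H) (by omega) (by rw [hc1.set 0 (by decide)]; exact hc0)
    fun c2 hc2 hc2' => ?_
  have h := hc1.trans hc2
  have hy : c2.elem 14 = y := by rw [h.elem]; simp
  have hx : c2.elem 13 = a.elem 13 := by rw [h.elem]; simp [hc.elem]
  have h3 : c2.set 3 = c.set 3 := by rw [h.set 3 (by decide)]; rfl
  have h2 : c2.set 0 = H := by rw [h.set 0 (by decide)]; exact hc0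
  have hs : (Fml.and (.mem 14 0) (.neg (.mem 13 4))).Sat c2.elem c2.set ↔
      y ∈ avoiding H (a.elem 13) := by
    simp only [Fml.sat_and, Fml.sat_mem, Fml.sat_neg, hy, hx, h2, hc2', hc1']
    rfl
  refine ⟨fun h7 => ?_, fun h7 => ?_⟩ <;>
  · rw [hs] at h7
    intro k hk
    rw [List.mem_append, List.mem_singleton] at hk
    by_cases hky : k = y
    · subst hky; simp [hy, h7]
    · simp [hy, h3, hky, hI k (hk.resolve_right hky)]

/-- A set fixed by `close` is a subgroup normal in `H`; `simpleIn_of_avoiding` turns the second test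
into simplicity of the quotient. Abelian simple quotients may also be caught, which does no harm. -/
theorem wp_insertIfMaximal {H : Subgroup G} {x : G} {𝒮 : Set (Subgroup G)} (h𝒮 : 𝒮.ncard ≤ B)
    (hH : ∀ N, SectionStep H N → N ∈ 𝒮) (hx : x ∈ H) (h0 : a.set 0 = H)
    (h3 : a.set 3 = avoiding H x) (hl : ListsIn 𝒮 (a.list 1)) :
    wp e K B .insertIfMaximal (fun c => ListsIn 𝒮 (c.list 1) ∧ (∀ S ∈ a.list 1, S ∈ c.list 1) ∧
      (∀ S ∈ c.list 1, S ∈ a.list 1 ∨ ∃ N, SectionStep H N ∧ (N : Set G) = S) ∧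
      ∀ N, SimpleIn N H → (N : Set G) = avoiding H x → (N : Set G) ∈ c.list 1) a := by
  refine wp_define (fun g => g ∈ avoiding H x) (fun g T => by simp [h3]) fun c1 hc1 hc1' => ?_
  refine wp_close (H := H) (by omega) (by rw [hc1.set 0 (by decide), h0]) fun c2 hc2 hc2' => ?_
  have h := hc1.trans hc2
  have hs3 : c2.set 3 = avoiding H x := by rw [h.set 3 (by decide), h3]
  have hs0 : c2.set 0 = H := by rw [h.set 0 (by decide), h0]
  have hl1 : c2.list 1 = a.list 1 := h.list 1 (by decide)
  have hs4 : c2.set 4 = ncl H (avoiding H x) := by rw [hc2', hc1']; rfl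
  refine ⟨fun hs => ?_, fun hs => ?_⟩ <;> rw [Fml.sat_eqSet, hs4, hs3] at hs
  swap
  · change ListsIn 𝒮 (c2.list 1) ∧ _
    rw [hl1]
    refine ⟨hl, fun _ h => h, fun _ h => .inl h, fun N hN hNx => absurd ?_ hs⟩
    rw [← hNx, ncl_eq_self hN.1]
  set M := ncl H (avoiding H x) with hM
  have hMH : NormalIn M H := normalIn_ncl fun _ h => h.1
  refine wp_generators (H := H) (by omega) (by omega) hs0 fun c3 hc3 hc3' => ?_
  have ht3 : c3.set 3 = M := by rw [hc3.set 3 (by decide), hs3, hs]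
  have ht0 : c3.set 0 = H := by rw [hc3.set 0 (by decide), hs0]
  have ht1 : c3.list 1 = a.list 1 := by rw [hc3.list 1 (by decide), hl1]
  have hV : c3.set 5 = {y | y ∈ H ∧ ncl H (insert y (M : Set G)) = H} := by
    rw [hc3', hs3, hs0, ← hs]
    ext y
    refine and_congr_right fun hy => ?_
    rw [SetLike.coe_set_eq]
  have hsat : (Fml.all 0 (.imp (.mem 0 0) (.or (.mem 0 3) (.mem 0 5)))).Sat c3.elem c3.set ↔
      SimpleIn M H := by
    simp only [Fml.sat_all, Fml.sat_imp, Fml.sat_or, Fml.sat_mem, Function.update_self, ht0, ht3,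
      hV]
    constructor
    · intro h
      exact simpleIn_of_avoiding hx hs hMH fun y hy => (h y hy).imp id fun h => h.2
    · intro h y hy
      by_cases hyM : y ∈ M
      · exact .inl hyM
      · exact .inr ⟨hy, h.ncl_insert hy hyM⟩
  refine ⟨fun hs' => ?_, fun hs' => ?_⟩ <;> rw [hsat] at hs'
  · refine wp_of_wp (wp_insert_listsIn h𝒮 (by omega) (by rwa [ht1]) ⟨M, hH M (.inr hs'), ht3.symm⟩)
      fun d hd hd' => ⟨hd'.1, fun S hS => ?_, fun S hS => ?_, fun N hN hNx => ?_⟩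
    · rw [hd'.2, ht1]
      exact .inl hS
    · rw [hd'.2, ht1, ht3] at hS
      exact hS.imp id fun h => ⟨M, .inr hs', h.symm⟩
    · rw [hd'.2, ht3, hNx, hs]
      exact .inr rfl
  · change ListsIn 𝒮 (c3.list 1) ∧ _
    rw [ht1]
    refine ⟨hl, fun _ h => h, fun _ h => .inl h, fun N hN hNx => absurd ?_ hs'⟩
    rwa [← SetLike.coe_injective (hNx.trans hs.symm)]

theorem wp_simpleSections {H : Subgroup G} {𝒮 : Set (Subgroup G)} (h𝒮 : 𝒮.ncard ≤ B)
    (hH : ∀ N, SectionStep H N → N ∈ 𝒮) (h0 : a.set 0 = H) (hl : ListsIn 𝒮 (a.list 1)) :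
    wp e K B .simpleSections (fun c => ListsIn 𝒮 (c.list 1) ∧ (∀ S ∈ a.list 1, S ∈ c.list 1) ∧
      (∀ S ∈ c.list 1, S ∈ a.list 1 ∨ ∃ N, SectionStep H N ∧ (N : Set G) = S) ∧
      ∀ N, SimpleIn N H → ¬ ⁅H, H⁆ ≤ N → (N : Set G) ∈ c.list 1) a := by
  have hfin : Finite G := Finite.of_equiv _ e.symm
  refine wp_forE (fun L c => ListsIn 𝒮 (c.list 1) ∧ (∀ S ∈ a.list 1, S ∈ c.list 1) ∧
      (∀ S ∈ c.list 1, S ∈ a.list 1 ∨ ∃ N, SectionStep H N ∧ (N : Set G) = S) ∧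
      ∀ x ∈ L, x ∈ H → ∀ N, SimpleIn N H → (N : Set G) = avoiding H x → (N : Set G) ∈ c.list 1)
      ⟨hl, fun _ h => h, fun _ h => .inl h, by simp⟩ ?_ ?_
  · rintro L x c hc ⟨h1, h2, h3, h4⟩
    have hc0 : c.set 0 = H := by rw [hc.set 0 (by decide), h0]
    refine ⟨fun hs => ?_, fun hs => ?_⟩
    · have hx : x ∈ H := by simpa [hc0] using hs
      refine wp_of_wp (C := .avoid) (wp_avoid (H := H) hc0) fun d hd hd' => ?_
      have hd0 : d.set 0 = H := by rw [hd.set 0 (by decide)]; exact hc0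
      have hd1 : d.list 1 = c.list 1 := by rw [hd.list 1 (by decide)]; rfl
      refine wp_mono ?_ _ (wp_insertIfMaximal (x := x) h𝒮 hH hx hd0 (by simpa using hd')
        (by rwa [hd1]))
      rintro f ⟨h5, h6, h7, h8⟩
      rw [hd1] at h6 h7
      refine ⟨h5, fun S hS => h6 S (h2 S hS), fun S hS => ?_, fun k hk hkH N hN hNk => ?_⟩
      · rcases h7 S hS with h9 | h9
        · exact h3 S h9
        · exact .inr h9
      · rw [List.mem_append, List.mem_singleton] at hk
        rcases hk with hk | rfl
        · exact h6 _ (h4 k hk hkH N hN hNk)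
        · exact h8 N hN hNk
    · have hx : x ∉ H := by simpa [hc0] using hs
      refine ⟨h1, h2, h3, fun k hk hkH N hN hNk => ?_⟩
      rw [List.mem_append, List.mem_singleton] at hk
      rcases hk with hk | rfl
      · exact h4 k hk hkH N hN hNk
      · exact absurd hkH hx
  · rintro c hc ⟨h1, h2, h3, h4⟩
    refine ⟨h1, h2, h3, fun N hN hNc => ?_⟩
    obtain ⟨x, hx, hNx⟩ := hN.eq_avoiding hNc
    exact h4 x (mem_elemList x) hx N hN hNx

/-- The family `𝒮` may exceed the sections of `H`, since list `1` accumulates over all subgroups of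
a level; its cardinality bounds the list that `insert` has to search. -/
theorem wp_sections {H : Subgroup G} {𝒮 : Set (Subgroup G)} (hB : n ≤ B) (h𝒮 : 𝒮.ncard ≤ B)
    (hH : ∀ N, SectionStep H N → N ∈ 𝒮) (h0 : a.set 0 = H) (hl : ListsIn 𝒮 (a.list 1)) :
    wp e K B .sections (fun c => ListsIn 𝒮 (c.list 1) ∧
      ∀ S, S ∈ c.list 1 ↔ S ∈ a.list 1 ∨ ∃ N, SectionStep H N ∧ (N : Set G) = S) a := by
  refine wp_of_wp (C := .cyclicSections) (wp_cyclicSections hB h0) fun c1 hc1 hc1' => ?_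
  have hl1 : c1.list 1 = a.list 1 := hc1.list 1 (by decide)
  refine wp_of_wp (C := .forL 2 2 (.insert 1 2)) (wp_insertAll (𝒮 := 𝒮) h𝒮 (by omega) (by omega)
    ⟨hc1'.1.1, fun S hS => ?_⟩ (by rwa [hl1])) fun c2 hc2 hc2' => ?_
  · obtain ⟨N, hN, rfl⟩ := hc1'.1.2 S hS
    exact ⟨N, hH N (.inl hN.2), rfl⟩
  have hs0 : c2.set 0 = H := by rw [hc2.set 0 (by decide), hc1.set 0 (by decide), h0]
  refine wp_mono ?_ _ (wp_simpleSections h𝒮 hH hs0 hc2'.1)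
  rintro d ⟨h1, h2, h3, h4⟩
  have h5 : ∀ S, S ∈ c2.list 1 ↔ S ∈ a.list 1 ∨ S ∈ c1.list 2 := by rw [← hl1]; exact hc2'.2
  refine ⟨h1, fun S => ⟨fun hS => ?_, ?_⟩⟩
  · rcases h3 S hS with h | h
    · rcases (h5 S).1 h with h | h
      · exact .inl h
      · obtain ⟨N, hN, rfl⟩ := hc1'.1.2 S h
        exact .inr ⟨N, .inl hN.2, rfl⟩
    · exact .inr h
  · have hcyc : ∀ N, CyclicIn N H → (N : Set G) ∈ d.list 1 := fun N hN =>
      h2 _ ((h5 _).2 (.inr (hc1'.2 N hN)))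
    rintro (h | ⟨N, hN | hN, rfl⟩)
    · exact h2 S ((h5 S).2 (.inl h))
    · exact hcyc N hN
    · by_cases hc : ⁅H, H⁆ ≤ N
      · exact hcyc N (hN.cyclicIn_of_commutator_le hc)
      · exact h4 N hN hc

/-- The list consists of the carriers of the subgroups in `𝒮`, without repetitions. -/
def ListsExactly (𝒮 : Set (Subgroup G)) (L : List (Set G)) : Prop :=
  ListsIn 𝒮 L ∧ ∀ N ∈ 𝒮, (N : Set G) ∈ L

theorem wp_descend {i : ℕ} (hB : n ≤ B) (h1 : (seriesLevel G i).ncard ≤ B)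
    (h2 : (seriesLevel G (i + 1)).ncard ≤ B) (hl : ListsExactly (seriesLevel G i) (a.list 0)) :
    wp e K B .descend (fun c => ListsExactly (seriesLevel G (i + 1)) (c.list 0)) a := by
  have hfin : Finite G := Finite.of_equiv _ e.symm
  refine wp_forL (fun L c => ListsIn (seriesLevel G (i + 1)) (c.list 1) ∧
    ∀ H : Subgroup G, (H : Set G) ∈ L → ∀ N, SectionStep H N → (N : Set G) ∈ c.list 1)
    (by simpa using hl.1.length_le h1) (by decide) ⟨by simpa using listsIn_nil _, by simp⟩ ?_ ?_
  · intro L S L' c hL hc hI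
    have hS : S ∈ a.list 0 := by
      have : S ∈ (a.setList 1 []).list 0 := by simp [hL]
      simpa using this
    obtain ⟨H, hH, rfl⟩ := hl.1.2 S hS
    refine wp_mono ?_ _ (wp_sections (H := H) hB h2 (fun N hN => ⟨H, hH, hN⟩) (by simp) hI.1)
    rintro d ⟨h3, h4⟩
    refine ⟨h3, fun H' hH' N hN => (h4 N).2 ?_⟩
    rw [List.mem_append, List.mem_singleton] at hH'
    rcases hH' with hH' | hH'
    · exact .inl (hI.2 H' hH' N hN)
    · obtain rfl := SetLike.coe_injective hH'
      exact .inr ⟨N, hN, rfl⟩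
  · intro c hc hI
    refine wp_mono ?_ _ (wp_insertAll (𝒮 := seriesLevel G (i + 1)) (a := c.setList 0 []) h2
      (by omega) (by omega) (by simpa using hI.1) (by simpa using listsIn_nil _))
    rintro d ⟨h3, h4⟩
    refine ⟨h3, ?_⟩
    rintro N ⟨H, hH, hN⟩
    rw [h4]
    exact .inr (by simpa using hI.2 H (by simpa using hl.2 H hH) N hN)

theorem sat_isInvariant {v : ℕ → G} {A : ℕ → Set G} {N : Subgroup G} (hA : A 0 = N) :
    Cmd.isInvariant.Sat v A ↔ N.Normal := by
  simp only [Cmd.isInvariant, Fml.sat_all, Fml.sat_imp, Fml.sat_and, Fml.sat_mem, Fml.sat_mul, hA]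
  constructor
  · intro h
    refine ⟨fun x hx g => ?_⟩
    simpa using h g x (g * x) (g * x * g⁻¹) (by simpa using hx)
  · rintro h g x y z ⟨h1, h2, h3⟩
    simp at h1 h2 h3 ⊢
    -- The formula expresses conjugation without inverses: `y = g * x` and `z * g = y`.
    have : z = g * x * g⁻¹ := by rw [h2, ← h3]; group
    rw [this]
    exact h.conj_mem x h1 g

theorem listsElements_numbers (A : Subgroup G) : ListsElements e A (numbers e (A : Set G)) := by
  refine ⟨List.nodup_range.filter _, fun x => ?_⟩
  simp only [numbers, numbersBelow, List.mem_filter, List.mem_range, decide_eq_true_eq,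
    SetLike.mem_coe]
  refine ⟨fun h => h.2, fun h => ⟨?_, h⟩⟩
  obtain ⟨g, -, rfl⟩ := h
  exact (e g).2

theorem wp_enumerate (hB : n ≤ B) (hlev : ∀ i ≤ K, (seriesLevel G i).ncard ≤ B)
    (hl : a.list 0 = []) (ho : a.out = []) :
    wp e K B .enumerate
      (fun c => OutputsSubgroups e (fun A => A ∈ seriesLevel G K ∧ A.Normal) c.out) a := by
  have hfin : Finite G := Finite.of_equiv _ e.symm
  refine wp_define (fun _ => True) (fun g T => ?_) fun c1 hc1 hc1' => ?_
  · simp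
  have hs0 : c1.set 0 = ((⊤ : Subgroup G) : Set G) := by rw [hc1']; simp
  have hl0 : c1.list 0 = [] := by rw [hc1.list 0 (by decide), hl]
  have ho1 : c1.out = [] := by rw [hc1.out rfl, ho]
  refine wp_rep (fun i c => ListsExactly (seriesLevel G i) (c.list 0)) ?_
    (fun i hi c hc hI => wp_descend hB (hlev i hi.le) (hlev (i + 1) hi) hI) fun c hc hI => ?_
  · refine ⟨⟨by simp [hl0], ?_⟩, ?_⟩
    · simp [hl0, hs0, seriesLevel]
    · simp [hl0, hs0, seriesLevel]
  have hco : c.out = [] := by rw [hc.out (by decide)]; exact ho1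
  refine wp_forL (fun L d => ∃ As : List (Subgroup G), As.Nodup ∧
    (∀ A, A ∈ As ↔ (A : Set G) ∈ L ∧ A.Normal) ∧
    d.out = (As.map fun A : Subgroup G => numbers e (A : Set G)).flatMap fun l => l.length :: l)
    (hI.1.length_le (hlev K le_rfl)) (by decide) ⟨[], by simp, by simp, by simpa using hco⟩ ?_ ?_
  · rintro L S L' d hL hd ⟨As, h1, h2, h3⟩
    obtain ⟨A, hA, rfl⟩ := hI.1.2 S (by simp [hL])
    have hnotin : (A : Set G) ∉ L := by
      have := hI.1.1
      rw [hL, List.nodup_append] at this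
      exact fun h => this.2.2 _ h _ (by simp) rfl
    have hmem : ∀ A' : Subgroup G,
        (A' : Set G) ∈ L ++ [(A : Set G)] ↔ (A' : Set G) ∈ L ∨ A' = A := by
      simp
    refine ⟨fun hs => ⟨As ++ [A], ?_, ?_, ?_⟩, fun hs => ⟨As, h1, ?_, h3⟩⟩ <;>
      (try rw [sat_isInvariant (N := A) (by simp)] at hs)
    · rw [List.nodup_append]
      refine ⟨h1, List.nodup_singleton _, ?_⟩
      rintro A' hA' T hT rfl
      rw [List.mem_singleton] at hT
      exact hnotin (hT ▸ ((h2 A').1 hA').1)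
    · intro A'
      rw [List.mem_append, List.mem_singleton, h2, hmem]
      constructor
      · rintro (⟨h, h'⟩ | rfl)
        · exact ⟨.inl h, h'⟩
        · exact ⟨.inr rfl, hs⟩
      · rintro ⟨h | h, h'⟩
        · exact .inl ⟨h, h'⟩
        · exact .inr h
    · simp [h3]
    · intro A'
      rw [h2, hmem]
      constructor
      · rintro ⟨h, h'⟩
        exact ⟨.inl h, h'⟩
      · rintro ⟨h | rfl, h'⟩
        · exact ⟨h, h'⟩
        · exact absurd h' hs
  · rintro d hd ⟨As, h1, h2, h3⟩
    refine ⟨As, As.map fun A : Subgroup G => numbers e (A : Set G), h1, fun A => ?_, ?_, h3⟩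
    · rw [h2]
      refine and_congr_left fun _ => ⟨fun h => ?_, hI.2 A⟩
      obtain ⟨N, hN, hNA⟩ := hI.1.2 _ h
      exact SetLike.coe_injective hNA ▸ hN
    · rw [List.forall₂_map_right_iff, List.forall₂_same]
      exact fun A _ => listsElements_numbers A

end

/-! ## The program -/

section

/-- For the trivial group the prescribed length is replaced by `0`; then the multiples of the
order of the group are stored in the array `1`. -/
def prepare : Prog :=
  .seq (.cond (.sub (.var 0) (.const 1)) .skip (.assign 1 (.const 0))) <|
  .countTo 0 4 (.seq (.store 1 (.var 4) (.var 7)) (.assign 7 (.add (.var 7) (.var 0))))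

/-- The program that outputs the normal subgroups whose quotients have a series of given length
with cyclic or simple factors. -/
def enumerationProg : Prog := .seq prepare (Cmd.enumerate.prog 0)

/-! ### Initial memory and total running time -/

variable {G : Type*} [Group G] {n : ℕ}

theorem cayleyInputWith_table (e : G ≃ Fin n) (k : ℕ) (g h : G) :
    (cayleyInputWith e k).arr 0 ((e g : ℕ) * n + e h) = e (g * h) := by
  have hlt : (e g : ℕ) * n + e h < n * n := by
    calc (e g : ℕ) * n + e h < e g * n + n := by have := (e h).2; omega
      _ = (e g + 1) * n := by ring
      _ ≤ n * n := Nat.mul_le_mul_right _ (e g).2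
  have hn : 0 < n := (Nat.zero_le _).trans_lt (e g).2
  have h1 : Fin.divNat ⟨(e g : ℕ) * n + e h, hlt⟩ = e g := by
    ext
    simp only [Fin.coe_divNat]
    rw [mul_comm, Nat.mul_add_div hn, Nat.div_eq_of_lt (e h).2, add_zero]
  have h2 : Fin.modNat ⟨(e g : ℕ) * n + e h, hlt⟩ = e h := by
    ext
    simp only [Fin.coe_modNat]
    rw [mul_comm, Nat.mul_add_mod, Nat.mod_eq_of_lt (e h).2]
  simp [cayleyInputWith, cayleyInput, hlt, h1, h2]

theorem runs_prepare {B : ℕ} (e : G ≃ Fin n) (k : ℕ) (hB : n ≤ B) :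
    Runs B prepare (cayleyInputWith e k) fun s =>
      Represents e (if n = 1 then 0 else k) s
        ⟨fun _ => e.symm ⟨0, (Nat.zero_le _).trans_lt (e 1).2⟩, fun _ => ∅, fun _ => [], []⟩ := by
  have hn : 0 < n := (Nat.zero_le _).trans_lt (e 1).2
  have hvar : ∀ x, (cayleyInputWith e k).var x = if x = 0 then n else if x = 1 then k else 0 := by
    intro x
    rcases x with _ | _ | x <;> simp [cayleyInputWith, cayleyInput]
  refine .seq ?_
  have h1 : Runs B (.cond (.sub (.var 0) (.const 1)) .skip (.assign 1 (.const 0)))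
      (cayleyInputWith e k) fun s => s =
        (cayleyInputWith e k).setVar 1 (if n = 1 then 0 else k) := by
    -- The order is positive, so the truncated difference `n - 1` vanishes only for the trivial
    -- group.
    refine .cond (fun hc => .skip ?_) (fun hc => .assign ?_)
    · simp only [Expr.eval, hvar, if_true] at hc
      rw [if_neg (by omega)]
      ext x <;> simp only [State.setVar_var, State.setVar_arr, State.setVar_out]
      split_ifs with hx
      · simp [hvar, hx]
      · rfl
    · simp only [Expr.eval, hvar, if_true] at hc
      rw [if_pos (by omega)]
      rfl
  refine h1.mono ?_
  rintro s rfl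
  refine .countTo n hB (by simp [hvar]) (by omega)
    (fun i s => (∀ x, x ≠ 4 → x ≠ 7 → s.var x =
      if x = 0 then n else if x = 1 then (if n = 1 then 0 else k) else 0) ∧ s.var 7 = i * n ∧
      (∀ b, b ≠ 1 → s.arr b = (cayleyInputWith e k).arr b) ∧ (∀ j < i, s.arr 1 j = j * n) ∧
      s.out = []) ?_ ?_ ?_
  · refine ⟨fun x h4 h7 => ?_, by simp [hvar], by simp, by simp,
      by simp [cayleyInputWith, cayleyInput]⟩
    simp only [State.setVar_var, h4, if_false, hvar]
    split_ifs <;> simp_all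
  · rintro i hi s h4 h0 ⟨hv, h7, ha, h1, ho⟩
    refine .seq (.store (.assign ⟨by simpa using h4, by simpa using h0, ?_⟩))
    refine ⟨fun x hx4 hx7 => ?_, ?_, fun b hb => ?_, fun j hj => ?_, ho⟩
    · simpa [hx4, hx7] using hv x hx4 hx7
    · simp [Expr.eval, h7, h0]; ring
    · ext j
      simp [Expr.eval, hb, ha b hb]
    · simp only [Expr.eval, State.setVar_arr, State.setArr_arr, h4, h7, true_and]
      split_ifs with hji
      · rw [hji]
      · exact h1 j (by omega)
  · rintro s ⟨hv, -, ha, h1, ho⟩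
    have harr : ∀ b, b ≠ 0 → b ≠ 1 → ∀ j, s.arr b j = 0 := by
      intro b hb0 hb1 j
      rw [ha b hb1]
      simp [cayleyInputWith, cayleyInput, hb0]
    exact
      { size := by simpa using hv 0 (by omega) (by omega)
        iter := by simpa using hv 1 (by omega) (by omega)
        table := fun g h => by rw [ha 0 (by omega), cayleyInputWith_table]
        offset := fun g => h1 _ (e g).2
        elem := fun x => by
          rw [hv _ (by omega) (by omega), if_neg (by omega), if_neg (by omega)]
          simp
        set := fun x g => by simp [harr (2 * x + 2) (by omega) (by omega)]
        len := fun l => by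
          rw [hv _ (by omega) (by omega), if_neg (by omega), if_neg (by omega)]
          simp
        row := fun l i hi => by simp at hi
        out := ho }

/-- This justifies ignoring the prescribed length for the trivial group: factors may be trivial, so
a series can be prolonged at will. -/
theorem seriesLevel_eq_of_subsingleton [Subsingleton G] (i j : ℕ) :
    seriesLevel G i = seriesLevel G j := by
  have h : ∀ i, (⊤ : Subgroup G) ∈ seriesLevel G i := by
    intro i
    induction i with
    | zero => rfl
    | succ i ih => exact ⟨⊤, ih, .inl ⟨normalIn_self _, 1, trivial, le_sup_left⟩⟩
  ext A
  rw [Subsingleton.elim A ⊤]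
  simp [h]

theorem runs_enumerationProg (e : G ≃ Fin n) {k : ℕ} (hk : 1 ≤ k) :
    Runs ((n ^ k) ^ 2) enumerationProg (cayleyInputWith e k) fun s =>
      OutputsSubgroups e (fun A => ∃ _ : A.Normal, HasCyclicOrSimpleSeries (G ⧸ A) k) s.out := by
  have hfin : Finite G := Finite.of_equiv _ e.symm
  have hGn : Nat.card G = n := by simpa using Nat.card_congr e
  have hn : 0 < n := (Nat.zero_le _).trans_lt (e 1).2
  have hnk : n ≤ n ^ k := Nat.le_self_pow (by omega) n
  have hsq : n ^ k ≤ (n ^ k) ^ 2 := Nat.le_self_pow (by omega) _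
  have hB : n ≤ (n ^ k) ^ 2 := hnk.trans hsq
  set K := if n = 1 then 0 else k with hK
  have hlevel : seriesLevel G K = seriesLevel G k := by
    rw [hK]
    split_ifs with h
    · have : Subsingleton G := (Nat.card_eq_one_iff_unique.1 (hGn.trans h)).1
      exact seriesLevel_eq_of_subsingleton _ _
    · rfl
  have hKB : K ≤ (n ^ k) ^ 2 := by
    rw [hK]
    split_ifs with h
    · omega
    -- For a nontrivial group the number of rounds is bounded through `k < n ^ k`.
    · exact ((Nat.lt_pow_self (show 1 < n by omega)).le).trans hsq
  have hlev : ∀ i ≤ K, (seriesLevel G i).ncard ≤ (n ^ k) ^ 2 := by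
    intro i hi
    refine (ncard_seriesLevel_le i).trans ?_
    rw [hGn]
    rw [hK] at hi
    split_ifs at hi with h
    · obtain rfl : i = 0 := by omega
      simp [h]
    -- Here `n ≥ 2`, so the factor 2 is absorbed by `n`; this is where the square in the bound comes
    -- from.
    · calc (2 * n) ^ i ≤ (n ^ 2) ^ i := Nat.pow_le_pow_left (by nlinarith [show 2 ≤ n by omega]) i
        _ ≤ (n ^ 2) ^ k := Nat.pow_le_pow_right (by positivity) hi
        _ = (n ^ k) ^ 2 := by rw [← pow_mul, ← pow_mul, mul_comm]
  refine .seq ((runs_prepare e k hB).mono fun s hs => ?_)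
  refine (Cmd.runs hB hKB Cmd.enumerate 0 hs (wp_enumerate hB hlev rfl rfl)).mono ?_
  rintro s' ⟨-, b, hb, hout⟩
  rw [hb.out]
  convert hout using 2 with A
  rw [hlevel]
  constructor
  · rintro ⟨h, hA⟩
    exact ⟨(hasCyclicOrSimpleSeries_quotient_iff A k).1 hA, h⟩
  · rintro ⟨hA, h⟩
    exact ⟨h, (hasCyclicOrSimpleSeries_quotient_iff A k).2 hA⟩

end

theorem mainTheorem10 :
    (∃ (P : RAM.Prog) (p : Polynomial ℕ), ∀ (G : Type*) [Group G] (n : ℕ) (e : G ≃ Fin n)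
      (k : ℕ), 1 ≤ k →
        FindsSubgroupsInTime e P (cayleyInputWith e k) (p.eval (n ^ k))
          (fun A => ∃ _ : A.Normal, HasCyclicOrSimpleSeries (G ⧸ A) k)) ∧
    (∃ (P : RAM.Prog) (p : Polynomial ℕ), ∀ (G : Type*) [Group G] (n : ℕ) (e : G ≃ Fin n),
        FindsSubgroupsInTime e P (cayleyInput e) (p.eval n)
          (fun A => ∃ _ : A.Normal, IsCyclicOrSimple (G ⧸ A))) := by
  -- Composing with the square of the indeterminate accounts for the loop bound `(n ^ k) ^ 2`.
  refine ⟨⟨enumerationProg, enumerationProg.time.comp (Polynomial.X ^ 2), ?_⟩,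
    ⟨.seq (.assign 1 (.const 1)) enumerationProg,
      (Prog.seq (.assign 1 (.const 1)) enumerationProg).time.comp (Polynomial.X ^ 2), ?_⟩⟩
  · intro G _ n e k hk
    obtain ⟨t, s, h1, h2, h3⟩ := runs_enumerationProg e hk
    exact ⟨t, s, h1, by simpa [Polynomial.eval_comp] using h2, h3⟩
  · intro G _ n e
    -- After the assignment the memory is definitionally the input with `k = 1`, and series of
    -- length one are treated by part (1).
    obtain ⟨t, s, h1, h2, h3⟩ : Runs ((n ^ 1) ^ 2) (.seq (.assign 1 (.const 1)) enumerationProg)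
        (cayleyInput e) _ := .seq (.assign (runs_enumerationProg e le_rfl))
    refine ⟨t, s, h1, by simpa [Polynomial.eval_comp] using h2, ?_⟩
    convert h3 using 2 with A
    exact exists_congr fun _ => (hasCyclicOrSimpleSeries_one_iff A).symm
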